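/- Let $\mathfrak g$ be a finite-dimensional simple Lie algebra over $\mathbb C$ with Cartan subalgebra $\mathfrak h$, root system $\Delta$, simple roots $\alpha_1,\dots,\alpha_l$ and positive roots $\Delta_+$. Let $\langle\cdot,\cdot\rangle$ be the nondegenerate invariant symmetric bilinear form on $\mathfrak g$ such that $\langle\alpha,\alpha\rangle=2$ for every long root $\alpha$, where $\mathfrak h^*$ is identified with $\mathfrak h$ via $\langle\cdot,\cdot\rangle$: $\alpha\in\mathfrak h^*$ corresponds to $t_\alpha\in\mathfrak h$ with $\alpha(h)=\langle t_\alpha,h\rangle$ for all $h\in\mathfrak h$. For each $\alpha\in\Delta_+$ fix root vectors $x_{\pm\alpha}\in\mathfrak g_{\pm\alpha}$ such that, with $h_\alpha=\frac{2}{\langle\alpha,\alpha\rangle}t_\alpha$, one has $[x_\alpha,x_{-\alpha}]=h_\alpha$ and $[h_\alpha,x_{\pm\alpha}]=\pm2x_{\pm\alpha}$. Let $\widehat{\mathfrak g}=\mathfrak g\otimes\mathbb C[t,t^{-1}]\oplus\mathbb CK$ be the affine Lie algebra, with $K$ central and $[a\otimes t^m,b\otimes t^n]=[a,b]\otimes t^{m+n}+m\langle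 a,b\rangle\delta_{m+n,0}K$. Let $k\ge1$ be an integer, and let $V(k,0)$ be the $\widehat{\mathfrak g}$-module induced from the one-dimensional module $\mathbb C\mathbb 1$ of $\mathfrak g\otimes\mathbb C[t]\oplus\mathbb CK$ on which $\mathfrak g\otimes\mathbb C[t]$ acts as $0$ and $K$ acts as $k$. Write $a(n)$ for the action of $a\otimes t^n$ on $V(k,0)$. Equip $V(k,0)$ with its standard vertex operator algebra structure, with vacuum $\mathbb 1$ and $Y(a(-1)\mathbb 1,z)=\sum_{n\in\mathbb Z}a(n)z^{-n-1}$ for $a\in\mathfrak g$; write $Y(u,z)=\sum_{n\in\mathbb Z}u_nz^{-n-1}$. Let $$V(k,0)(0)=\{v\in V(k,0)\mid h(0)v=0\ \text{for all } h\in\mathfrak h\}.$$ Then $V(k,0)(0)$ is generated, as a vertex operator algebra, by the vectors $\alpha_i(-1)\mathbb 1$ $(1\le i\le l)$, where $\alpha_i(-1)=t_{\alpha_i}(-1)$, and $x_{-\alpha}(-2)x_\alpha(-1)\mathbb 1$ $(\alpha\in\Delta_+)$. That is, $V(k,0)(0)$ is the smallest subspace of $V(k,0)$ that contains $\mathbb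 1$ and these vectors and is closed under all products $(u,v)\mapsto u_nv$, $n\in\mathbb Z$. -/

import Mathlib

noncomputable section
namespace AffineVOA
section Fields
open VertexOperator (ncoeff)
variable {R V : Type*} [CommRing R] [AddCommGroup V] [Module R V]

theorem exists_ncoeff_eq_zero (A : VertexOperator R V) (v : V) :
    ∃ N : ℤ, ∀ n, N ≤ n → ncoeff A n v = 0 := by
  refine ⟨-((HahnModule.of R).symm (A v)).order, fun n hn => ?_⟩
  apply VertexOperator.ncoeff_eq_zero_of_lt_order
  omega

theorem ncoeff_ext {A B : VertexOperator R V} (h : ∀ n v, ncoeff A n v = ncoeff B n v) :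
    A = B := by
  apply HVertexOperator.coeff_inj
  funext n
  ext v
  simpa using h (-n - 1) v

/-- The vertex operator `∑ n, f n z^(-n-1)`. -/
def ofModes (f : ℤ → Module.End R V) (hf : ∀ v, ∃ N : ℤ, ∀ n, N ≤ n → f n v = 0) :
    VertexOperator R V :=
  VertexOperator.of_coeff (fun n => f (-n - 1)) (by
    intro v
    obtain ⟨N, hN⟩ := hf v
    refine ⟨-N - 1, fun n hn => ?_⟩
    by_contra hlt
    exact hn (hN _ (by omega)))

@[simp] theorem ncoeff_ofModes (f : ℤ → Module.End R V) (hf) (n : ℤ) :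
    ncoeff (ofModes f hf) n = f n := by
  simp [ofModes]

/-- The coefficient `(-1)^j * binom(n, j)` of `z^j` in `(1 - z)^n`. -/
def sgnChoose (n : ℤ) (j : ℕ) : ℤ := (-1) ^ j * Ring.choose n j

theorem sgnChoose_conv (m n : ℤ) (r : ℕ) :
    ∑ x ∈ Finset.HasAntidiagonal.antidiagonal r, sgnChoose m x.1 * sgnChoose n x.2 =
      sgnChoose (m + n) r := by
  unfold sgnChoose
  rw [Ring.add_choose_eq _ (Commute.all m n), Finset.mul_sum]
  refine Finset.sum_congr rfl fun x hx => ?_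
  rw [← Finset.HasAntidiagonal.mem_antidiagonal.mp hx, pow_add]
  ring

theorem sgnChoose_sub_mul (m : ℤ) (i : ℕ) :
    (m - i) * sgnChoose m i = m * sgnChoose (m - 1) i := by
  unfold sgnChoose
  have h : (m - i) * Ring.choose m i = m * Ring.choose (m - 1) i := by
    cases i with
    | zero => simp
    | succ i =>
      have h1 := Ring.choose_succ_succ (m - 1) i
      rw [sub_add_cancel] at h1
      have h2 := Ring.choose_smul_choose (m - 1) (Nat.le_succ i)
      simp only [Nat.succ_eq_add_one, Nat.choose_succ_self_right, Nat.add_sub_cancel_left,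
        Ring.choose_one_right, nsmul_eq_mul] at h2
      push_cast at h2 ⊢
      linear_combination (-(i : ℤ) - 1) * h1 + m * h1 - h2
  linear_combination (-1) ^ i * h

theorem finite_of_fst {f : ℕ × ℕ → V} (N : ℕ) (h1 : ∀ i j, N ≤ i → f (i, j) = 0)
    (h2 : ∀ i, ∃ M : ℕ, ∀ j, M ≤ j → f (i, j) = 0) : f.HasFiniteSupport := by
  choose M hM using h2
  refine Set.Finite.subset (s := ((Finset.range N ×ˢ
    Finset.range ((Finset.range N).sup M) : Finset (ℕ × ℕ)) : Set (ℕ × ℕ)))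
    (Finset.finite_toSet _) ?_
  rintro ⟨i, j⟩ hij
  simp only [Finset.coe_product, Finset.coe_range, Set.mem_prod, Set.mem_Iio]
  have hi : i < N := by
    by_contra h
    exact hij (h1 i j (by omega))
  refine ⟨hi, ?_⟩
  by_contra h
  have := Finset.le_sup (f := M) (Finset.mem_range.mpr hi)
  exact hij (hM i j (by omega))

theorem finite_of_snd {f : ℕ × ℕ → V} (N : ℕ) (h1 : ∀ i j, N ≤ j → f (i, j) = 0)
    (h2 : ∀ j, ∃ M : ℕ, ∀ i, M ≤ i → f (i, j) = 0) : f.HasFiniteSupport := by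
  have h : (f ∘ Prod.swap).HasFiniteSupport :=
    finite_of_fst N (fun i j hi => h1 j i hi) (fun i => h2 i)
  have h' := h.comp_of_injective (g := Prod.swap) Prod.swap_injective
  simpa [Function.comp_assoc] using h'

theorem finsum_conv (w : ℕ × ℕ → ℤ) (G : ℕ → V) (N : ℕ) (hG : ∀ r, N ≤ r → G r = 0) :
    ∑ᶠ x : ℕ × ℕ, w x • G (x.1 + x.2) =
      ∑ᶠ r : ℕ, (∑ x ∈ Finset.HasAntidiagonal.antidiagonal r, w x) • G r := by
  have hs : (Function.support fun x : ℕ × ℕ => w x • G (x.1 + x.2)) ⊆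
      ((Finset.range N ×ˢ Finset.range N).filter (fun x => x.1 + x.2 < N) : Finset (ℕ × ℕ)) := by
    intro x hx
    have : x.1 + x.2 < N := by
      by_contra h
      exact hx (by simp [hG _ (not_lt.mp h)])
    simp only [Finset.coe_filter, Finset.mem_product, Finset.mem_range, Set.mem_ofPred_eq]
    omega
  have hr : (Function.support fun r : ℕ =>
      (∑ x ∈ Finset.HasAntidiagonal.antidiagonal r, w x) • G r) ⊆ (Finset.range N : Set ℕ) := by
    intro r hr
    by_contra h
    exact hr (by simp [hG r (by simpa using h)])
  rw [finsum_eq_sum_of_support_subset _ hs, finsum_eq_sum_of_support_subset _ hr,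
    ← Finset.sum_fiberwise_of_maps_to (g := fun x : ℕ × ℕ => x.1 + x.2) (t := Finset.range N)
      (by simp)]
  refine Finset.sum_congr rfl fun r hr => ?_
  rw [Finset.sum_smul]
  refine Finset.sum_congr ?_ ?_
  · ext x
    simp only [Finset.mem_filter, Finset.mem_product, Finset.mem_range,
      Finset.HasAntidiagonal.mem_antidiagonal] at hr ⊢
    omega
  · intro x hx
    rw [Finset.HasAntidiagonal.mem_antidiagonal.mp hx]

/-- The modes of the `n`-th product of two vertex operators (the Borcherds iterate formula). -/
def nthProductMode (A B : VertexOperator R V) (n m : ℤ) (v : V) : V :=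
  ∑ᶠ j : ℕ, sgnChoose n j •
    (ncoeff A (n - j) (ncoeff B (m + j) v) -
      (n.negOnePow : ℤ) • ncoeff B (m + n - j) (ncoeff A j v))

theorem nthProductMode_aux (A B : VertexOperator R V) (v : V) :
    ∃ N : ℕ, (∀ n : ℤ, N ≤ n → ncoeff A n v = 0) ∧ (∀ n : ℤ, N ≤ n → ncoeff B n v = 0) := by
  obtain ⟨a, ha⟩ := exists_ncoeff_eq_zero A v
  obtain ⟨b, hb⟩ := exists_ncoeff_eq_zero B v
  exact ⟨(max a b).toNat, fun n hn => ha n (by omega), fun n hn => hb n (by omega)⟩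

theorem nthProductMode_finite (A B : VertexOperator R V) (n m : ℤ) (v : V) :
    (fun j : ℕ => sgnChoose n j •
      (ncoeff A (n - j) (ncoeff B (m + j) v) -
      (n.negOnePow : ℤ) • ncoeff B (m + n - j) (ncoeff A j v))).HasFiniteSupport := by
  obtain ⟨N, hA, hB⟩ := nthProductMode_aux A B v
  refine Set.Finite.subset (Finset.finite_toSet (Finset.range (N + m.natAbs))) ?_
  intro j hj
  by_contra h
  simp only [Finset.coe_range, Set.mem_Iio, not_lt] at h
  exact hj (by simp only [hA j (by omega), hB (m + j) (by omega)]; simp)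

/-- The `n`-th product `A(z)_n B(z)` of two vertex operators, given by
`(A_n B)_m = ∑_{j ≥ 0} (-1)^j binom(n, j) (A_{n-j} B_{m+j} - (-1)^n B_{m+n-j} A_j)`. -/
def nthProduct (A B : VertexOperator R V) (n : ℤ) : VertexOperator R V :=
  ofModes (fun m =>
    { toFun := nthProductMode A B n m
      map_add' := fun v w => by
        unfold nthProductMode
        rw [← finsum_add_distrib (nthProductMode_finite A B n m v)
          (nthProductMode_finite A B n m w)]
        refine finsum_congr fun j => ?_
        simp only [map_add, ← smul_add]
        congr 1
        simp only [smul_add]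
        abel
      map_smul' := fun r v => by
        unfold nthProductMode
        rw [RingHom.id_apply, smul_finsum' r (nthProductMode_finite A B n m v)]
        refine finsum_congr fun j => ?_
        simp only [map_smul]
        rw [smul_comm r (sgnChoose n j), smul_comm (n.negOnePow : ℤ) r, ← smul_sub] })
    (by
      intro v
      obtain ⟨N, hA, hB⟩ := nthProductMode_aux A B v
      have h : ∀ j : ℕ, ∃ M : ℤ, ∀ p, M ≤ p → ncoeff B p (ncoeff A j v) = 0 :=
        fun j => exists_ncoeff_eq_zero B _
      choose M hM using h
      refine ⟨max N ((∑ j ∈ Finset.range N, |M j|) + N + |n|), fun m hm => ?_⟩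
      simp only [LinearMap.coe_mk, AddHom.coe_mk, nthProductMode]
      rw [← finsum_zero (α := ℕ)]
      refine finsum_congr fun j => ?_
      rw [hB (m + j) (by have := le_max_left (N : ℤ) ((∑ j ∈ Finset.range N, |M j|) + N + |n|); omega)]
      have : ncoeff B (m + n - j) (ncoeff A j v) = 0 := by
        by_cases hj : N ≤ j
        · rw [hA j (by omega)]; simp
        · apply hM
          have h1 : |M j| ≤ ∑ j ∈ Finset.range N, |M j| :=
            Finset.single_le_sum (f := fun j => |M j|) (fun i _ => abs_nonneg _)
              (Finset.mem_range.mpr (not_le.mp hj))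
          have h2 := le_max_right (N : ℤ) ((∑ j ∈ Finset.range N, |M j|) + N + |n|)
          have h3 := le_abs_self (M j)
          have h4 := neg_abs_le n
          omega
      rw [this]; simp)

theorem ncoeff_nthProduct (A B : VertexOperator R V) (n m : ℤ) (v : V) :
    ncoeff (nthProduct A B n) m v = ∑ᶠ j : ℕ, sgnChoose n j •
      (ncoeff A (n - j) (ncoeff B (m + j) v) -
        (n.negOnePow : ℤ) • ncoeff B (m + n - j) (ncoeff A j v)) := by
  simp [nthProduct, nthProductMode]

theorem eventually_zero (A : VertexOperator R V) (v : V) (p : ℤ) :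
    ∃ N : ℕ, ∀ j : ℕ, N ≤ j → ncoeff A (p + j) v = 0 := by
  obtain ⟨a, ha⟩ := exists_ncoeff_eq_zero A v
  exact ⟨(a - p).toNat, fun j hj => ha _ (by omega)⟩

theorem finite_zsmul {ι : Type*} {f : ι → V} (hf : f.HasFiniteSupport) (w : ι → ℤ) :
    (fun x => w x • f x).HasFiniteSupport :=
  Set.Finite.subset hf fun x hx h => hx (by simp only [h, smul_zero])

/-- The four families of terms in a double product. -/
theorem double_finite (A B C : VertexOperator R V) (m n p : ℤ) (v : V) :
    (fun x : ℕ × ℕ => ncoeff A (m - x.1) (ncoeff B (n - x.2) (ncoeff C (p + (x.1 + x.2 : ℕ)) v))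
      ).HasFiniteSupport ∧
    (fun x : ℕ × ℕ => ncoeff A (m - x.1) (ncoeff C (p + n + x.1 - x.2) (ncoeff B x.2 v))
      ).HasFiniteSupport ∧
    (fun x : ℕ × ℕ => ncoeff B (n - x.2) (ncoeff C (p + m - x.1 + x.2) (ncoeff A x.1 v))
      ).HasFiniteSupport ∧
    (fun x : ℕ × ℕ => ncoeff C (p + m + n - (x.1 + x.2 : ℕ)) (ncoeff B x.2 (ncoeff A x.1 v))
      ).HasFiniteSupport := by
  obtain ⟨N, hN⟩ := eventually_zero C v p
  obtain ⟨NA, hA⟩ := eventually_zero A v 0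
  obtain ⟨NB, hB⟩ := eventually_zero B v 0
  simp only [zero_add] at hA hB
  refine ⟨?_, ?_, ?_, ?_⟩
  · exact finite_of_fst N (fun i j h => by simp only [hN (i + j) (by omega), map_zero])
      (fun i => ⟨N, fun j h => by simp only [hN (i + j) (by omega), map_zero]⟩)
  · refine finite_of_snd NB (fun i j h => by simp only [hB j h, map_zero]) (fun j => ?_)
    obtain ⟨M, hM⟩ := eventually_zero C (ncoeff B j v) (p + n - j)
    refine ⟨M, fun i hi => ?_⟩
    simp only [show p + n + (i : ℤ) - j = p + n - j + i by ring, hM i hi, map_zero]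
  · refine finite_of_fst NA (fun i j h => by simp only [hA i h, map_zero]) (fun i => ?_)
    obtain ⟨M, hM⟩ := eventually_zero C (ncoeff A i v) (p + m - i)
    refine ⟨M, fun j hj => ?_⟩
    simp only [hM j hj, map_zero]
  · refine finite_of_fst NA (fun i j h => by simp only [hA i h, map_zero]) (fun i => ?_)
    obtain ⟨M, hM⟩ := eventually_zero B (ncoeff A i v) 0
    refine ⟨M, fun j hj => ?_⟩
    have := hM j hj
    rw [zero_add] at this
    simp only [this, map_zero]

theorem ncoeff_nthProduct_nthProduct (A B C : VertexOperator R V) (m n p : ℤ) (v : V) :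
    ncoeff (nthProduct A (nthProduct B C n) m) p v =
      ∑ᶠ x : ℕ × ℕ, (sgnChoose m x.1 * sgnChoose n x.2) •
        (ncoeff A (m - x.1) (ncoeff B (n - x.2) (ncoeff C (p + (x.1 + x.2 : ℕ)) v))
        - (n.negOnePow : ℤ) •
          ncoeff A (m - x.1) (ncoeff C (p + n + x.1 - x.2) (ncoeff B x.2 v))
        - (m.negOnePow : ℤ) •
          ncoeff B (n - x.2) (ncoeff C (p + m - x.1 + x.2) (ncoeff A x.1 v))
        + ((m + n).negOnePow : ℤ) •
          ncoeff C (p + m + n - (x.1 + x.2 : ℕ)) (ncoeff B x.2 (ncoeff A x.1 v))) := by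
  obtain ⟨h1, h2, h3, h4⟩ := double_finite A B C m n p v
  rw [finsum_curry]
  · rw [ncoeff_nthProduct]
    refine finsum_congr fun i => ?_
    rw [ncoeff_nthProduct, ncoeff_nthProduct,
      map_finsum _ (nthProductMode_finite B C n (p + i) v),
      smul_finsum' _ (nthProductMode_finite B C n (p + m - i) (ncoeff A i v)),
      ← finsum_sub_distrib, smul_finsum']
    · refine finsum_congr fun j => ?_
      simp only [map_sub, map_zsmul, smul_sub, smul_add, mul_smul, Int.negOnePow_add,
        Units.val_mul]
      have e1 : p + (i : ℤ) + j = p + (i + j : ℕ) := by push_cast; ring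
      have e2 : p + (i : ℤ) + n - j = p + n + i - j := by ring
      have e3 : p + m - (i : ℤ) + n - j = p + m + n - (i + j : ℕ) := by push_cast; ring
      rw [e1, e2, e3]
      simp only [smul_comm (sgnChoose n j) (m.negOnePow : ℤ)]
      abel
    · exact ((nthProductMode_finite B C n (p + i) v).fun_comp
        (map_zero (ncoeff A (m - i)))).fun_sub ((nthProductMode_finite B C n (p + m - i) (ncoeff A i v)).fun_comp
          (smul_zero (m.negOnePow : ℤ)))
    · exact (nthProductMode_finite B C n (p + i) v).fun_comp (map_zero _)
    · exact (nthProductMode_finite B C n (p + m - i) (ncoeff A i v)).fun_comp (smul_zero _)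
  · exact finite_zsmul (((h1.fun_sub (finite_zsmul h2 _)).fun_sub (finite_zsmul h3 _)).fun_add
      (finite_zsmul h4 _)) (fun x : ℕ × ℕ => sgnChoose m x.1 * sgnChoose n x.2)

theorem nthProduct_comm {A B D : VertexOperator R V} {c : R}
    (h : ∀ m n v, ncoeff A m (ncoeff B n v) - ncoeff B n (ncoeff A m v) =
      ncoeff D (m + n) v + (if m + n = 0 then (m : R) * c else 0) • v)
    (C : VertexOperator R V) (m n : ℤ) :
    nthProduct A (nthProduct B C n) m - nthProduct B (nthProduct A C m) n =
      nthProduct D C (m + n) + (if m + n = 0 then (m : R) * c else 0) • C := by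
  apply ncoeff_ext
  intro p v
  rw [map_sub, map_add, map_smul]
  simp only [Pi.sub_apply, Pi.add_apply, Pi.smul_apply, LinearMap.sub_apply, LinearMap.add_apply,
    LinearMap.smul_apply]
  obtain ⟨N, hN⟩ := eventually_zero C v p
  obtain ⟨ND, hD⟩ := eventually_zero D v 0
  simp only [zero_add] at hD
  have hfin : ∀ (A B : VertexOperator R V) (m n : ℤ),
      (fun x : ℕ × ℕ => (sgnChoose m x.1 * sgnChoose n x.2) •
        (ncoeff A (m - x.1) (ncoeff B (n - x.2) (ncoeff C (p + (x.1 + x.2 : ℕ)) v))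
        - (n.negOnePow : ℤ) •
          ncoeff A (m - x.1) (ncoeff C (p + n + x.1 - x.2) (ncoeff B x.2 v))
        - (m.negOnePow : ℤ) •
          ncoeff B (n - x.2) (ncoeff C (p + m - x.1 + x.2) (ncoeff A x.1 v))
        + ((m + n).negOnePow : ℤ) •
          ncoeff C (p + m + n - (x.1 + x.2 : ℕ)) (ncoeff B x.2 (ncoeff A x.1 v)))
        ).HasFiniteSupport := by
    intro A B m n
    obtain ⟨h1, h2, h3, h4⟩ := double_finite A B C m n p v
    exact finite_zsmul (((h1.fun_sub (finite_zsmul h2 _)).fun_sub (finite_zsmul h3 _)).fun_add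
      (finite_zsmul h4 _)) (fun x : ℕ × ℕ => sgnChoose m x.1 * sgnChoose n x.2)
  -- the three sums that survive in the commutator
  let G1 : ℕ → V := fun r => ncoeff D (m + n - r) (ncoeff C (p + r) v)
  let G2 : ℕ → V := fun r => if m + n = r then c • ncoeff C (p + r) v else 0
  let G3 : ℕ → V := fun r => ncoeff C (p + m + n - r) (ncoeff D r v)
  have hG1 : ∀ r, N ≤ r → G1 r = 0 := fun r hr => by simp only [G1, hN r hr, map_zero]
  have hG2 : ∀ r, N ≤ r → G2 r = 0 := fun r hr => by simp only [G2, hN r hr, smul_zero, ite_self]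
  have hG3 : ∀ r, ND ≤ r → G3 r = 0 := fun r hr => by simp only [G3, hD r hr, map_zero]
  have hfG : ∀ (G : ℕ → V) (M : ℕ) (w : ℕ × ℕ → ℤ), (∀ r, M ≤ r → G r = 0) →
      (fun x : ℕ × ℕ => w x • G (x.1 + x.2)).HasFiniteSupport := fun G M w hG =>
    finite_zsmul (finite_of_fst M (fun i j hi => hG _ (by omega))
      (fun i => ⟨M, fun j hj => hG _ (by omega)⟩)) w
  have hfG' : ∀ (G : ℕ → V) (M : ℕ) (w : ℕ → ℤ), (∀ r, M ≤ r → G r = 0) →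
      (fun r : ℕ => w r • G r).HasFiniteSupport := fun G M w hG =>
    finite_zsmul (Set.Finite.subset (Finset.finite_toSet (Finset.range M)) fun r hr => by
      by_contra hh
      exact hr (hG r (by simpa using hh))) w
  have key : ncoeff (nthProduct A (nthProduct B C n) m) p v -
      ncoeff (nthProduct B (nthProduct A C m) n) p v =
      ∑ᶠ x : ℕ × ℕ, ((sgnChoose m x.1 * sgnChoose n x.2) • G1 (x.1 + x.2)
        + (((m - x.1) * sgnChoose m x.1) * sgnChoose n x.2) • G2 (x.1 + x.2)
        - (((m + n).negOnePow : ℤ) * (sgnChoose m x.1 * sgnChoose n x.2)) •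
          G3 (x.1 + x.2)) := by
    rw [ncoeff_nthProduct_nthProduct A B, ncoeff_nthProduct_nthProduct B A,
      ← finsum_comp_equiv (Equiv.prodComm ℕ ℕ) (f := fun x : ℕ × ℕ =>
        (sgnChoose n x.1 * sgnChoose m x.2) • _), ← finsum_sub_distrib (hfin A B m n)]
    · refine finsum_congr fun x => ?_
      obtain ⟨i, j⟩ := x
      simp only [Equiv.prodComm_apply, Prod.swap, G1, G2, G3]
      have e1 := h (m - i) (n - j) (ncoeff C (p + (i + j : ℕ)) v)
      have e2 := congrArg (ncoeff C (p + m + n - (i + j : ℕ))) (h i j v)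
      have e3 : (if (i : ℤ) + j = 0 then ((i : ℤ) : R) * c else 0) = 0 := by
        split_ifs with h0
        · have : i = 0 := by omega
          simp [this]
        · rfl
      rw [e3, zero_smul, add_zero, map_sub] at e2
      have e4 : (if m - i + (n - j) = 0 then ((m - i : ℤ) : R) * c else 0) •
          ncoeff C (p + (i + j : ℕ)) v = (m - i) • (if m + n = (i + j : ℕ) then
            c • ncoeff C (p + (i + j : ℕ)) v else 0) := by
        by_cases h0 : m + n = (i + j : ℕ)
        · rw [if_pos h0, if_pos (by push_cast at h0; omega), mul_smul, Int.cast_smul_eq_zsmul]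
        · rw [if_neg h0, if_neg (by push_cast at h0; omega), zero_smul, smul_zero]
      rw [e4] at e1
      rw [mul_comm (m - i : ℤ), mul_assoc, mul_comm (m - i : ℤ), ← mul_assoc, mul_smul _ (m - i : ℤ),
        mul_comm ((m + n).negOnePow : ℤ), mul_smul _ ((m + n).negOnePow : ℤ),
        mul_comm (sgnChoose n j), ← smul_sub, ← smul_add, ← smul_sub]
      congr 1
      have a1 : m + n - ((i + j : ℕ) : ℤ) = m - i + (n - j) := by push_cast; ring
      have a2 : (((i + j : ℕ) : ℤ)) = (i : ℤ) + j := by push_cast; ring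
      have a3 : ((j + i : ℕ) : ℤ) = ((i + j : ℕ) : ℤ) := by rw [add_comm j i]
      have a4 : p + n - (j : ℤ) + i = p + n + i - j := by ring
      have a5 : p + m + (j : ℤ) - i = p + m - i + j := by ring
      have a6 : p + n + m = p + m + n := by ring
      have e2' : ncoeff C (p + m + n - (i + j : ℕ)) (ncoeff D ((i + j : ℕ) : ℤ) v) =
          ncoeff C (p + m + n - (i + j : ℕ)) (ncoeff A i (ncoeff B j v)) -
          ncoeff C (p + m + n - (i + j : ℕ)) (ncoeff B j (ncoeff A i v)) := by
        rw [e2, a2]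
      rw [e2', a1, a3, a4, a5, a6, add_comm n m, smul_sub]
      have e1' := eq_sub_of_add_eq e1.symm
      rw [e1']
      abel
    · exact (hfin B A n m).comp_of_injective (Equiv.injective (Equiv.prodComm ℕ ℕ))
  rw [key, finsum_sub_distrib, finsum_add_distrib, finsum_conv _ G1 N hG1,
    finsum_conv (fun x : ℕ × ℕ => ((m - x.1) * sgnChoose m x.1) * sgnChoose n x.2) G2 N hG2,
    finsum_conv (fun x : ℕ × ℕ => ((m + n).negOnePow : ℤ) * (sgnChoose m x.1 * sgnChoose n x.2))
      G3 ND hG3, ncoeff_nthProduct]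
  · simp only [← Finset.mul_sum, sgnChoose_conv, sgnChoose_sub_mul, mul_assoc]
    have hR : ∑ᶠ j : ℕ, sgnChoose (m + n) j • (ncoeff D (m + n - j) (ncoeff C (p + j) v) -
        ((m + n).negOnePow : ℤ) • ncoeff C (p + (m + n) - j) (ncoeff D j v)) =
        ∑ᶠ r : ℕ, sgnChoose (m + n) r • G1 r -
        ∑ᶠ r : ℕ, (((m + n).negOnePow : ℤ) * sgnChoose (m + n) r) • G3 r := by
      rw [← finsum_sub_distrib (hfG' G1 N _ hG1) (hfG' G3 ND _ hG3)]
      refine finsum_congr fun r => ?_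
      rw [smul_sub, mul_comm, mul_smul, ← add_assoc p m n]
    have hM : ∑ᶠ r : ℕ, (m * sgnChoose (m - 1 + n) r) • G2 r =
        (if m + n = 0 then (m : R) * c else 0) • ncoeff C p v := by
      rw [finsum_eq_single _ 0]
      · simp only [G2]
        split_ifs with h1 h2 h2
        · simp [sgnChoose, mul_smul, Int.cast_smul_eq_zsmul]
        · exact absurd (by simpa using h1) h2
        · exact absurd (by simpa using h2) h1
        · simp
      · intro r hr
        by_cases h1 : m + n = r
        · obtain ⟨s, rfl⟩ := Nat.exists_eq_succ_of_ne_zero hr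
          have : m - 1 + n = (s : ℕ) := by push_cast at h1; omega
          have h0 : sgnChoose (m - 1 + n) (s + 1) = 0 := by
            rw [this, sgnChoose, Ring.choose_natCast]
            simp
          rw [Nat.succ_eq_add_one, h0]
          simp
        · simp [G2, h1]
    rw [hR, hM]
    abel
  · exact hfG G1 N _ hG1
  · exact hfG G2 N _ hG2
  · exact (hfG G1 N _ hG1).fun_add (hfG G2 N _ hG2)
  · exact hfG G3 ND _ hG3

theorem nthProduct_add_left (A A' B : VertexOperator R V) (n : ℤ) :
    nthProduct (A + A') B n = nthProduct A B n + nthProduct A' B n := by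
  apply ncoeff_ext
  intro m v
  rw [map_add, Pi.add_apply, LinearMap.add_apply]
  simp only [ncoeff_nthProduct]
  rw [← finsum_add_distrib (nthProductMode_finite A B n m v) (nthProductMode_finite A' B n m v)]
  refine finsum_congr fun j => ?_
  simp only [map_add, Pi.add_apply, LinearMap.add_apply, ← smul_add]
  congr 1
  simp only [smul_add]
  abel

theorem nthProduct_add_right (A B B' : VertexOperator R V) (n : ℤ) :
    nthProduct A (B + B') n = nthProduct A B n + nthProduct A B' n := by
  apply ncoeff_ext
  intro m v
  rw [map_add, Pi.add_apply, LinearMap.add_apply]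
  simp only [ncoeff_nthProduct]
  rw [← finsum_add_distrib (nthProductMode_finite A B n m v) (nthProductMode_finite A B' n m v)]
  refine finsum_congr fun j => ?_
  simp only [map_add, Pi.add_apply, LinearMap.add_apply, ← smul_add]
  congr 1
  simp only [smul_add]
  abel

theorem nthProduct_smul_left (r : R) (A B : VertexOperator R V) (n : ℤ) :
    nthProduct (r • A) B n = r • nthProduct A B n := by
  apply ncoeff_ext
  intro m v
  rw [map_smul, Pi.smul_apply, LinearMap.smul_apply]
  simp only [ncoeff_nthProduct]
  rw [smul_finsum' r (nthProductMode_finite A B n m v)]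
  refine finsum_congr fun j => ?_
  simp only [map_smul, Pi.smul_apply, LinearMap.smul_apply]
  rw [smul_comm r (sgnChoose n j), smul_comm (n.negOnePow : ℤ) r, ← smul_sub]

theorem nthProduct_smul_right (r : R) (A B : VertexOperator R V) (n : ℤ) :
    nthProduct A (r • B) n = r • nthProduct A B n := by
  apply ncoeff_ext
  intro m v
  rw [map_smul, Pi.smul_apply, LinearMap.smul_apply]
  simp only [ncoeff_nthProduct]
  rw [smul_finsum' r (nthProductMode_finite A B n m v)]
  refine finsum_congr fun j => ?_
  simp only [map_smul, Pi.smul_apply, LinearMap.smul_apply]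
  rw [smul_comm r (sgnChoose n j), smul_comm (n.negOnePow : ℤ) r, ← smul_sub]

/-- The identity field, all of whose modes vanish except the mode `-1`. -/
def idField : VertexOperator R V :=
  ofModes (fun n => if n = -1 then LinearMap.id else 0)
    (fun v => ⟨0, fun n hn => by rw [if_neg (by omega)]; rfl⟩)

theorem ncoeff_idField (n : ℤ) (v : V) :
    ncoeff (idField : VertexOperator R V) n v = if n = -1 then v else 0 := by
  rw [idField, ncoeff_ofModes]
  split_ifs <;> rfl

/-- Expansion of `A(z)_n B(z)` applied to a vector in the case where `B` is the identity field. -/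
theorem ncoeff_nthProduct_idField (A : VertexOperator R V) (n m : ℤ) (v : V) :
    ncoeff (nthProduct A idField n) m v = ∑ᶠ j : ℕ, sgnChoose n j •
      ((if m + j = -1 then ncoeff A (n - j) v else 0) -
        (n.negOnePow : ℤ) • (if m + n - j = -1 then ncoeff A j v else 0)) := by
  rw [ncoeff_nthProduct]
  refine finsum_congr fun j => ?_
  simp only [ncoeff_idField]
  split_ifs <;> simp

theorem nthProduct_idField_of_nonneg (A : VertexOperator R V) (n : ℤ) (hn : 0 ≤ n) :
    nthProduct A idField n = 0 := by
  apply ncoeff_ext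
  intro m v
  rw [ncoeff_nthProduct_idField, map_zero, Pi.zero_apply, LinearMap.zero_apply]
  obtain ⟨n, rfl⟩ := Int.eq_ofNat_of_zero_le hn
  have hz : ∀ j : ℕ, n < j → sgnChoose (n : ℤ) j = 0 := fun j hj => by
    rw [sgnChoose, Ring.choose_natCast, Nat.choose_eq_zero_of_lt hj]
    simp
  have hsub : ∀ j : ℕ, sgnChoose n j •
      ((if m + j = -1 then ncoeff A (n - j) v else 0) -
        ((n : ℤ).negOnePow : ℤ) • (if m + n - j = -1 then ncoeff A j v else 0)) =
      (if m + j = -1 then sgnChoose n j • ncoeff A (m + n + 1) v else 0) -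
        (if m + n - j = -1 then
          (sgnChoose n j * ((n : ℤ).negOnePow : ℤ)) • ncoeff A (m + n + 1) v else 0) := fun j => by
    rw [smul_sub]
    congr 1
    · split_ifs with h
      · rw [show (n : ℤ) - j = m + n + 1 by omega]
      · rw [smul_zero]
    · split_ifs with h
      · rw [show (j : ℤ) = m + n + 1 by omega, mul_smul]
      · rw [smul_zero, smul_zero]
  simp only [hsub]
  by_cases h : m < 0 ∧ 0 ≤ m + n + 1
  · obtain ⟨h1, h2⟩ := h
    obtain ⟨a, ha⟩ := Int.eq_ofNat_of_zero_le (show 0 ≤ -1 - m by omega)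
    obtain ⟨b, hb⟩ := Int.eq_ofNat_of_zero_le h2
    have hab : n = a + b := by omega
    rw [finsum_sub_distrib, finsum_eq_single _ a, finsum_eq_single _ b]
    · rw [if_pos (by omega), if_pos (by omega), ← sub_smul]
      convert zero_smul ℤ _
      subst hab
      have hs : (a + b).choose b = (a + b).choose a := Nat.choose_symm_add.symm
      simp only [sgnChoose, Ring.choose_natCast, Int.coe_negOnePow_natCast, hs, pow_add]
      ring_nf
      have h2 : ((-1 : ℤ) ^ b) ^ 2 = 1 := by rw [← pow_mul, mul_comm, pow_mul]; norm_num
      simp only [mul_comm b 2, pow_mul]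
      norm_num
    · intro i hi
      rw [if_neg (by omega)]
    · intro i hi
      rw [if_neg (by omega)]
    · refine Set.Finite.subset (Set.finite_singleton a) fun i hi => ?_
      by_contra hne
      have hne' : i ≠ a := hne
      exact hi (if_neg (by omega))
    · refine Set.Finite.subset (Set.finite_singleton b) fun i hi => ?_
      by_contra hne
      have hne' : i ≠ b := hne
      exact hi (if_neg (by omega))
  · refine (finsum_congr fun j => ?_).trans ((finsum_congr fun j => sub_self (0 : V)).trans finsum_zero)
    by_cases hj : n < j
    · simp [hz j hj]
    · rw [if_neg (by omega), if_neg (by omega)]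

theorem nthProduct_idField_neg_one (A : VertexOperator R V) :
    nthProduct A idField (-1) = A := by
  apply ncoeff_ext
  intro m v
  rw [ncoeff_nthProduct_idField]
  have h1 : ∀ j, sgnChoose (-1) j = 1 := fun j => by
    have : Ring.choose (-1 : ℤ) j = (-1) ^ j := by
      rw [Ring.choose_neg', Ring.multichoose_one, Units.smul_def, Int.coe_negOnePow_natCast]
      simp
    rw [sgnChoose, this, ← mul_pow]
    simp
  simp only [h1, one_smul]
  by_cases hm : m < 0
  · obtain ⟨j, hj⟩ := Int.eq_ofNat_of_zero_le (show 0 ≤ -1 - m by omega)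
    rw [finsum_eq_single _ j]
    · rw [if_pos (by omega), if_neg (by omega)]
      rw [show -1 - (j : ℤ) = m by omega]
      simp
    · intro i hi
      rw [if_neg (by omega), if_neg (by omega)]
      simp
  · obtain ⟨j, hj⟩ := Int.eq_ofNat_of_zero_le (show 0 ≤ m by omega)
    rw [finsum_eq_single _ j]
    · rw [if_neg (by omega), if_pos (by omega), ← hj]
      simp
    · intro i hi
      rw [if_neg (by omega), if_neg (by omega)]
      simp

end Fields

section Affine
open VertexOperator (ncoeff)
open LieAlgebra LieAlgebra.LoopAlgebra
open scoped TensorProduct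
attribute [local instance 100] LieRing.ofAssociativeRing

variable {𝔤 : Type*} [LieRing 𝔤] [LieAlgebra ℂ 𝔤]

variable (𝔤) in
/-- An invariant symmetric bilinear form on a complex Lie algebra. -/
structure InvariantForm where
  /-- the underlying bilinear form -/
  form : LinearMap.BilinForm ℂ 𝔤
  /-- `⟨[x, y], z⟩ = -⟨y, [x, z]⟩` -/
  invariant : form.lieInvariant 𝔤
  symm : form.IsSymm

variable (Φ : InvariantForm 𝔤)

/-- The negative of an invariant form. -/
def InvariantForm.neg : InvariantForm 𝔤 where
  form := -Φ.form
  invariant := fun x y z => by simp [Φ.invariant x y z]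
  symm := ⟨fun x y => by simp [Φ.symm.eq x y]⟩

/-- The 2-cocycle `(a ⊗ t^m, b ⊗ t^n) ↦ m ⟨a, b⟩ δ_{m+n,0}` on the loop algebra. (In Mathlib the
cocycle attached to a form is `n ⟨a, b⟩ δ_{m+n,0} = -m ⟨a, b⟩ δ_{m+n,0}`, hence the sign.) -/
abbrev affineCocycle := twoCocycleOfBilinear ℂ ℤ 𝔤 Φ.neg.form Φ.neg.invariant Φ.neg.symm

/-- The affine Lie algebra `𝔤 ⊗ ℂ[t, t⁻¹] ⊕ ℂ K`, with
`[a ⊗ t^m, b ⊗ t^n] = [a, b] ⊗ t^(m+n) + m ⟨a, b⟩ δ_{m+n,0} K` and `K` central. -/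
def AffineLie := LieAlgebra.ofTwoCocycle (affineCocycle Φ)

instance : LieRing (AffineLie Φ) := inferInstanceAs (LieRing (LieAlgebra.ofTwoCocycle _))
instance : LieAlgebra ℂ (AffineLie Φ) :=
  inferInstanceAs (LieAlgebra ℂ (LieAlgebra.ofTwoCocycle _))

/-- `a ⊗ t^n` -/
def loopElt (a : 𝔤) (n : ℤ) : AffineLie Φ :=
  LieAlgebra.ofProd (affineCocycle Φ) (AddMonoidAlgebra.single n (1 : ℂ) ⊗ₜ[ℂ] a, 0)

/-- The central element `K`. -/
def centralElt : AffineLie Φ :=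
  LieAlgebra.ofProd (affineCocycle Φ) (0, (TrivialLieModule.equiv ℂ (loopAlgebra ℂ ℤ 𝔤) ℂ).symm 1)

theorem lie_loopElt (a b : 𝔤) (m n : ℤ) :
    ⁅loopElt Φ a m, loopElt Φ b n⁆ = loopElt Φ ⁅a, b⁆ (m + n) +
      (if m + n = 0 then (m : ℂ) * Φ.form a b else 0) • centralElt Φ := by
  refine (LieAlgebra.bracket_ofTwoCocycle _ _).trans ?_
  apply (LieAlgebra.ofProd (affineCocycle Φ)).symm.injective
  refine Prod.ext ?_ ?_
  · change ⁅AddMonoidAlgebra.single m (1 : ℂ) ⊗ₜ[ℂ] a, AddMonoidAlgebra.single n (1 : ℂ) ⊗ₜ[ℂ] b⁆ =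
      AddMonoidAlgebra.single (m + n) (1 : ℂ) ⊗ₜ[ℂ] ⁅a, b⁆ + _ • 0
    rw [smul_zero, add_zero, LieAlgebra.ExtendScalars.bracket_tmul,
      AddMonoidAlgebra.single_mul_single, one_mul]
  · change residuePairing ℂ ℤ 𝔤 (-Φ.form) (AddMonoidAlgebra.single m (1 : ℂ) ⊗ₜ[ℂ] a)
      (AddMonoidAlgebra.single n (1 : ℂ) ⊗ₜ[ℂ] b) + 0 - 0 = 0 + _ * 1
    rw [residuePairing_apply_apply, toFinsupp_single_tmul, toFinsupp_single_tmul,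
      Finsupp.sum_single_index (by simp)]
    by_cases h : m + n = 0
    · have h' : m = -n := by omega
      subst h'
      simp
    · rw [Finsupp.single_eq_of_ne (by omega), if_neg h]
      simp

theorem lie_centralElt (x : AffineLie Φ) : ⁅x, centralElt Φ⁆ = 0 := by
  refine (LieAlgebra.bracket_ofTwoCocycle _ _).trans ?_
  apply (LieAlgebra.ofProd (affineCocycle Φ)).symm.injective
  refine Prod.ext ?_ ?_
  · exact lie_zero (M := loopAlgebra ℂ ℤ 𝔤) ((LieAlgebra.ofProd (affineCocycle Φ)).symm x).1
  · change residuePairing ℂ ℤ 𝔤 (-Φ.form) ((LieAlgebra.ofProd (affineCocycle Φ)).symm x).1 0 + 0 - 0 = (0 : ℂ)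
    rw [map_zero, add_zero, sub_zero]

theorem affineLie_induction {p : AffineLie Φ → Prop} (hadd : ∀ x y, p x → p y → p (x + y))
    (hloop : ∀ a n, p (loopElt Φ a n)) (hK : ∀ c : ℂ, p (c • centralElt Φ)) (x : AffineLie Φ) :
    p x := by
  let e : loopAlgebra ℂ ℤ 𝔤 → ℂ → AffineLie Φ := fun y c => LieAlgebra.ofProd (affineCocycle Φ)
    (y, (TrivialLieModule.equiv ℂ (loopAlgebra ℂ ℤ 𝔤) ℂ).symm c)
  have he : ∀ y y' c c', e (y + y') (c + c') = e y c + e y' c' := fun _ _ _ _ => rfl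
  have hK' : ∀ c, e 0 c = c • centralElt Φ := fun c => by
    apply (LieAlgebra.ofProd (affineCocycle Φ)).symm.injective
    exact Prod.ext (smul_zero _).symm (mul_one c).symm
  have h0 : p (e 0 0) := by rw [hK']; exact hK 0
  have hy : ∀ y, p (e y 0) := by
    intro y
    obtain ⟨f, rfl⟩ := (toFinsupp ℂ ℤ 𝔤).symm.surjective y
    induction f using Finsupp.induction_linear with
    | zero => rw [map_zero]; exact h0
    | add f g hf hg =>
      have h := hadd _ _ hf hg
      rwa [← he, add_zero, ← map_add] at h
    | single n a =>
      rw [toFinsupp_symm_single]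
      exact hloop a n
  obtain ⟨⟨y, c⟩, rfl⟩ := (LieAlgebra.ofProd (affineCocycle Φ)).surjective x
  have h := hadd _ _ (hy y) (hK (TrivialLieModule.equiv ℂ (loopAlgebra ℂ ℤ 𝔤) ℂ c))
  rwa [← hK', ← he, add_zero, zero_add] at h

/-- The linear map `ĝ → E` determined by `a ⊗ t^n ↦ f n a` and `K ↦ e`. -/
def affineLift {E : Type*} [AddCommMonoid E] [Module ℂ E] (f : ℤ → 𝔤 →ₗ[ℂ] E) (e : E) :
    AffineLie Φ →ₗ[ℂ] E where
  toFun x := Finsupp.lsum ℂ f (toFinsupp ℂ ℤ 𝔤 ((LieAlgebra.ofProd (affineCocycle Φ)).symm x).1) +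
    TrivialLieModule.equiv ℂ (loopAlgebra ℂ ℤ 𝔤) ℂ ((LieAlgebra.ofProd (affineCocycle Φ)).symm x).2 • e
  map_add' x y := by
    have h1 : ((LieAlgebra.ofProd (affineCocycle Φ)).symm (x + y)) =
      (LieAlgebra.ofProd (affineCocycle Φ)).symm x + (LieAlgebra.ofProd (affineCocycle Φ)).symm y := LieAlgebra.of_symm_add _ x y
    rw [h1, Prod.fst_add, Prod.snd_add]
    simp only [map_add, add_smul]
    abel
  map_smul' c x := by
    have h1 : ((LieAlgebra.ofProd (affineCocycle Φ)).symm (c • x)) =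
      c • (LieAlgebra.ofProd (affineCocycle Φ)).symm x := LieAlgebra.of_symm_smul _ c x
    rw [h1, Prod.smul_fst, Prod.smul_snd]
    simp only [map_smul, smul_assoc, RingHom.id_apply, smul_add]

@[simp] theorem affineLift_loopElt {E : Type*} [AddCommMonoid E] [Module ℂ E]
    (f : ℤ → 𝔤 →ₗ[ℂ] E) (e : E) (a : 𝔤) (n : ℤ) :
    affineLift Φ f e (loopElt Φ a n) = f n a := by
  change Finsupp.lsum ℂ f (toFinsupp ℂ ℤ 𝔤 (AddMonoidAlgebra.single n (1 : ℂ) ⊗ₜ[ℂ] a)) +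
    (0 : ℂ) • e = f n a
  rw [toFinsupp_single_tmul, Finsupp.lsum_single, zero_smul, add_zero]

@[simp] theorem affineLift_centralElt {E : Type*} [AddCommMonoid E] [Module ℂ E]
    (f : ℤ → 𝔤 →ₗ[ℂ] E) (e : E) :
    affineLift Φ f e (centralElt Φ) = e := by
  change Finsupp.lsum ℂ f (toFinsupp ℂ ℤ 𝔤 0) + (1 : ℂ) • e = e
  rw [map_zero, map_zero, zero_add, one_smul]

variable (k : ℂ)

/-- The left ideal of `U(ĝ)` generated by `𝔤 ⊗ ℂ[t]` and `K - k`. -/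
def vacuumIdeal : Submodule (UniversalEnvelopingAlgebra ℂ (AffineLie Φ))
    (UniversalEnvelopingAlgebra ℂ (AffineLie Φ)) :=
  Submodule.span _
    ({u | ∃ (a : 𝔤) (n : ℤ), 0 ≤ n ∧ u = UniversalEnvelopingAlgebra.ι ℂ (loopElt Φ a n)} ∪
      {UniversalEnvelopingAlgebra.ι ℂ (centralElt Φ) - algebraMap ℂ _ k})

/-- The generalized Verma module `V(k,0)`: the `ĝ`-module induced from the one-dimensional module
of `𝔤 ⊗ ℂ[t] ⊕ ℂ K` on which `𝔤 ⊗ ℂ[t]` acts as `0` and `K` acts as `k`. -/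
def VacuumModule := UniversalEnvelopingAlgebra ℂ (AffineLie Φ) ⧸ vacuumIdeal Φ k

instance : AddCommGroup (VacuumModule Φ k) :=
  inferInstanceAs (AddCommGroup (_ ⧸ vacuumIdeal Φ k))
instance : Module (UniversalEnvelopingAlgebra ℂ (AffineLie Φ)) (VacuumModule Φ k) :=
  inferInstanceAs (Module (UniversalEnvelopingAlgebra ℂ (AffineLie Φ)) (_ ⧸ vacuumIdeal Φ k))
instance : Module ℂ (VacuumModule Φ k) :=
  inferInstanceAs (Module ℂ (_ ⧸ vacuumIdeal Φ k))
instance : IsScalarTower ℂ (UniversalEnvelopingAlgebra ℂ (AffineLie Φ)) (VacuumModule Φ k) :=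
  inferInstanceAs (IsScalarTower ℂ (UniversalEnvelopingAlgebra ℂ (AffineLie Φ))
    (_ ⧸ vacuumIdeal Φ k))

/-- The vacuum vector `𝟙`. -/
def vacuum : VacuumModule Φ k := Submodule.Quotient.mk 1

/-- The operator on `V(k,0)` given by an element of `ĝ`. -/
def affineAct (x : AffineLie Φ) : Module.End ℂ (VacuumModule Φ k) :=
  Algebra.lsmul ℂ ℂ (VacuumModule Φ k) (UniversalEnvelopingAlgebra.ι ℂ x)

/-- The operator `a(n)` on `V(k,0)`, the action of `a ⊗ t^n`. -/
def mode (a : 𝔤) (n : ℤ) : Module.End ℂ (VacuumModule Φ k) :=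
  Algebra.lsmul ℂ ℂ (VacuumModule Φ k) (UniversalEnvelopingAlgebra.ι ℂ (loopElt Φ a n))

theorem subalgebra_eq_top {L : Type*} [LieRing L] [LieAlgebra ℂ L]
    (S : Subalgebra ℂ (UniversalEnvelopingAlgebra ℂ L))
    (h : ∀ x, UniversalEnvelopingAlgebra.ι ℂ x ∈ S) (u : UniversalEnvelopingAlgebra ℂ L) :
    u ∈ S := by
  obtain ⟨t, rfl⟩ := RingCon.mkₐ_surjective (α := ℂ) (UniversalEnvelopingAlgebra.ringCon ℂ L) u
  change UniversalEnvelopingAlgebra.mkAlgHom ℂ L t ∈ S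
  induction t using TensorAlgebra.induction with
  | algebraMap r => rw [AlgHom.commutes]; exact S.algebraMap_mem r
  | ι x => exact h x
  | mul a b ha hb => rw [map_mul]; exact S.mul_mem ha hb
  | add a b ha hb => rw [map_add]; exact S.add_mem ha hb

theorem mem_vacuumIdeal_central (u : UniversalEnvelopingAlgebra ℂ (AffineLie Φ)) :
    UniversalEnvelopingAlgebra.ι ℂ (centralElt Φ) * u - k • u ∈ vacuumIdeal Φ k := by
  have hc : ∀ u, u ∈ Subalgebra.centralizer ℂ {UniversalEnvelopingAlgebra.ι ℂ (centralElt Φ)} := by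
    apply subalgebra_eq_top
    intro x
    rw [Subalgebra.mem_centralizer_iff]
    rintro _ rfl
    have h := (UniversalEnvelopingAlgebra.ι ℂ).map_lie x (centralElt Φ)
    rw [lie_centralElt, map_zero, LieRing.of_associative_ring_bracket] at h
    exact (sub_eq_zero.mp h.symm).symm
  have h1 := (Subalgebra.mem_centralizer_iff _).mp (hc u) _ rfl
  rw [h1, Algebra.smul_def, Algebra.commutes k u, ← mul_sub]
  exact Submodule.smul_mem _ u (Submodule.subset_span (Or.inr rfl))

theorem central_smul (v : VacuumModule Φ k) :
    UniversalEnvelopingAlgebra.ι ℂ (centralElt Φ) • v = k • v := by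
  obtain ⟨u, rfl⟩ := Submodule.Quotient.mk_surjective _ v
  exact (Submodule.Quotient.eq _).mpr (mem_vacuumIdeal_central Φ k u)

theorem mode_apply (a : 𝔤) (n : ℤ) (v : VacuumModule Φ k) :
    mode Φ k a n v = UniversalEnvelopingAlgebra.ι ℂ (loopElt Φ a n) • v := rfl

theorem mode_comm (a b : 𝔤) (m n : ℤ) (v : VacuumModule Φ k) :
    mode Φ k a m (mode Φ k b n v) - mode Φ k b n (mode Φ k a m v) =
      mode Φ k ⁅a, b⁆ (m + n) v + (if m + n = 0 then (m : ℂ) * (Φ.form a b * k) else 0) • v := by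
  simp only [mode_apply]
  rw [smul_smul, smul_smul, ← sub_smul, ← LieRing.of_associative_ring_bracket, ← LieHom.map_lie,
    lie_loopElt, map_add, map_smul, add_smul, smul_assoc, central_smul, smul_smul]
  congr 2
  split_ifs <;> ring

theorem mode_vacuum (a : 𝔤) (n : ℤ) (hn : 0 ≤ n) : mode Φ k a n (vacuum Φ k) = 0 := by
  refine (Submodule.Quotient.mk_eq_zero (vacuumIdeal Φ k)).mpr ?_
  change UniversalEnvelopingAlgebra.ι ℂ (loopElt Φ a n) * 1 ∈ vacuumIdeal Φ k
  rw [mul_one]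
  exact Submodule.subset_span (Or.inl ⟨a, n, hn, rfl⟩)

/-- Every subspace of `V(k,0)` containing the vacuum and stable under all `a(n)` is everything. -/
theorem vacuumModule_induction (W : Submodule ℂ (VacuumModule Φ k)) (h1 : vacuum Φ k ∈ W)
    (h : ∀ a n, ∀ v ∈ W, mode Φ k a n v ∈ W) (v : VacuumModule Φ k) : v ∈ W := by
  let S : Subalgebra ℂ (UniversalEnvelopingAlgebra ℂ (AffineLie Φ)) :=
    { carrier := {u | ∀ v ∈ W, u • v ∈ W}
      mul_mem' := fun {a b} ha hb v hv => by rw [mul_smul]; exact ha _ (hb _ hv)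
      add_mem' := fun {a b} ha hb v hv => by rw [add_smul]; exact W.add_mem (ha _ hv) (hb _ hv)
      algebraMap_mem' := fun r v hv => by rw [algebraMap_smul]; exact W.smul_mem r hv }
  have hS : ∀ u, u ∈ S := by
    apply subalgebra_eq_top
    intro x
    induction x using affineLie_induction with
    | hadd x y hx hy => rw [map_add]; exact S.add_mem hx hy
    | hloop a n => exact fun v hv => h a n v hv
    | hK c =>
      intro v hv
      rw [map_smul, smul_assoc, central_smul]
      exact W.smul_mem _ (W.smul_mem _ hv)
  obtain ⟨u, rfl⟩ := Submodule.Quotient.mk_surjective _ v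
  have := hS u _ h1
  change Submodule.Quotient.mk (u * 1) ∈ W at this
  rwa [mul_one] at this

theorem mode_truncated (a : 𝔤) (v : VacuumModule Φ k) :
    ∃ N : ℤ, ∀ n, N ≤ n → mode Φ k a n v = 0 := by
  let W : Submodule ℂ (VacuumModule Φ k) :=
    { carrier := {v | ∀ a, ∃ N : ℤ, ∀ n, N ≤ n → mode Φ k a n v = 0}
      add_mem' := fun {v w} hv hw a => by
        obtain ⟨N, hN⟩ := hv a
        obtain ⟨M, hM⟩ := hw a
        exact ⟨max N M, fun n hn => by
          rw [map_add, hN n (le_trans (le_max_left _ _) hn),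
            hM n (le_trans (le_max_right _ _) hn), add_zero]⟩
      zero_mem' := fun a => ⟨0, fun n _ => map_zero _⟩
      smul_mem' := fun r v hv a => by
        obtain ⟨N, hN⟩ := hv a
        exact ⟨N, fun n hn => by rw [map_smul, hN n hn, smul_zero]⟩ }
  refine vacuumModule_induction Φ k W (fun a => ⟨0, fun n hn => mode_vacuum Φ k a n hn⟩) ?_ v a
  intro b m v hv a
  obtain ⟨N, hN⟩ := hv a
  obtain ⟨M, hM⟩ := hv ⁅a, b⁆
  refine ⟨max N (max (M - m) (1 - m)), fun n hn => ?_⟩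
  have h1 := le_trans (le_max_left _ _) hn
  have h2 := le_trans (le_trans (le_max_left _ _) (le_max_right _ _)) hn
  have h3 := le_trans (le_trans (le_max_right _ _) (le_max_right _ _)) hn
  have h := mode_comm Φ k a b n m v
  rw [hN n h1, map_zero, sub_zero, hM (n + m) (by omega), if_neg (by omega), zero_smul,
    add_zero] at h
  exact h

/-- The field `a(z) = ∑ n, a(n) z^(-n-1)`. -/
def currentField (a : 𝔤) : VertexOperator ℂ (VacuumModule Φ k) :=
  ofModes (fun n => mode Φ k a n) (mode_truncated Φ k a)

theorem ncoeff_currentField (a : 𝔤) (n : ℤ) (v : VacuumModule Φ k) :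
    ncoeff (currentField Φ k a) n v = mode Φ k a n v := by
  rw [currentField, ncoeff_ofModes]

theorem loopElt_add (a b : 𝔤) (n : ℤ) :
    loopElt Φ (a + b) n = loopElt Φ a n + loopElt Φ b n := by
  apply (LieAlgebra.ofProd (affineCocycle Φ)).symm.injective
  refine Prod.ext (TensorProduct.tmul_add _ _ _) (add_zero _).symm

theorem loopElt_smul (r : ℂ) (a : 𝔤) (n : ℤ) :
    loopElt Φ (r • a) n = r • loopElt Φ a n := by
  apply (LieAlgebra.ofProd (affineCocycle Φ)).symm.injective
  refine Prod.ext (TensorProduct.tmul_smul _ _ _) (smul_zero _).symm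

theorem currentField_add (a b : 𝔤) :
    currentField Φ k (a + b) = currentField Φ k a + currentField Φ k b := by
  apply ncoeff_ext
  intro n v
  rw [map_add, Pi.add_apply, LinearMap.add_apply]
  simp only [ncoeff_currentField, mode_apply, loopElt_add, map_add, add_smul]

theorem currentField_smul (r : ℂ) (a : 𝔤) :
    currentField Φ k (r • a) = r • currentField Φ k a := by
  apply ncoeff_ext
  intro n v
  rw [map_smul, Pi.smul_apply, LinearMap.smul_apply]
  simp only [ncoeff_currentField, mode_apply, loopElt_smul, map_smul, smul_assoc]

/-- The operator `B(z) ↦ a(z)_n B(z)` on fields, linear in `a`. -/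
def fieldMode (n : ℤ) : 𝔤 →ₗ[ℂ] Module.End ℂ (VertexOperator ℂ (VacuumModule Φ k)) where
  toFun a :=
    { toFun := fun B => nthProduct (currentField Φ k a) B n
      map_add' := fun B B' => nthProduct_add_right _ B B' n
      map_smul' := fun r B => nthProduct_smul_right r _ B n }
  map_add' a b := by
    ext1 B
    change nthProduct (currentField Φ k (a + b)) B n = nthProduct _ B n + nthProduct _ B n
    rw [← nthProduct_add_left, ← currentField_add]
  map_smul' r a := by
    ext1 B
    change nthProduct (currentField Φ k (r • a)) B n = r • nthProduct _ B n
    rw [← nthProduct_smul_left, ← currentField_smul]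

theorem fieldMode_apply (n : ℤ) (a : 𝔤) (B : VertexOperator ℂ (VacuumModule Φ k)) :
    fieldMode Φ k n a B = nthProduct (currentField Φ k a) B n := rfl

theorem fieldMode_comm (a b : 𝔤) (m n : ℤ) :
    fieldMode Φ k m a * fieldMode Φ k n b - fieldMode Φ k n b * fieldMode Φ k m a =
      fieldMode Φ k (m + n) ⁅a, b⁆ +
        (if m + n = 0 then (m : ℂ) * Φ.form a b else 0) • (k • 1) := by
  ext1 B
  have h := nthProduct_comm (A := currentField Φ k a) (B := currentField Φ k b)
    (D := currentField Φ k ⁅a, b⁆) (c := Φ.form a b * k)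
    (fun m n v => by simpa only [ncoeff_currentField] using mode_comm Φ k a b m n v) B m n
  refine h.trans ?_
  rw [LinearMap.add_apply, fieldMode_apply, LinearMap.smul_apply, LinearMap.smul_apply,
    Module.End.one_apply, smul_smul]
  congr 2
  split_ifs
  · ring
  · ring

/-- The linear map underlying `fieldRep`. -/
def fieldLin : AffineLie Φ →ₗ[ℂ] Module.End ℂ (VertexOperator ℂ (VacuumModule Φ k)) :=
  affineLift Φ (fieldMode Φ k) (k • 1)

theorem fieldLin_loopElt (a : 𝔤) (n : ℤ) :
    fieldLin Φ k (loopElt Φ a n) = fieldMode Φ k n a := affineLift_loopElt Φ _ _ a n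

theorem fieldLin_centralElt : fieldLin Φ k (centralElt Φ) = k • 1 := affineLift_centralElt Φ _ _

theorem fieldLin_lie (x y : AffineLie Φ) :
    fieldLin Φ k ⁅x, y⁆ =
      fieldLin Φ k x *
        fieldLin Φ k y -
      fieldLin Φ k y *
        fieldLin Φ k x := by
  induction x using affineLie_induction with
  | hadd x x' hx hx' => rw [add_lie, map_add, hx, hx', map_add, add_mul, mul_add]; abel
  | hK c =>
    rw [smul_lie, ← lie_skew, lie_centralElt, neg_zero, smul_zero, map_zero, map_smul,
      fieldLin_centralElt]
    ext1 B
    simp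
  | hloop a m =>
    induction y using affineLie_induction with
    | hadd y y' hy hy' => rw [lie_add, map_add, hy, hy', map_add, add_mul, mul_add]; abel
    | hK c =>
      rw [lie_smul, lie_centralElt, smul_zero, map_zero, map_smul, fieldLin_centralElt]
      ext1 B
      simp
    | hloop b n =>
      rw [lie_loopElt, map_add, map_smul, fieldLin_loopElt, fieldLin_loopElt,
        fieldLin_loopElt, fieldLin_centralElt, fieldMode_comm]

/-- The action of `ĝ` on the space of all fields on `V(k,0)`: `a ⊗ t^n` acts by
`B(z) ↦ a(z)_n B(z)`, and `K` acts by `k`. -/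
def fieldRep : AffineLie Φ →ₗ⁅ℂ⁆ Module.End ℂ (VertexOperator ℂ (VacuumModule Φ k)) :=
  { fieldLin Φ k with
    map_lie' := fun {x y} => fieldLin_lie Φ k x y }

/-- The action of `U(ĝ)` on the space of all fields on `V(k,0)`. -/
def fieldAct : UniversalEnvelopingAlgebra ℂ (AffineLie Φ) →ₐ[ℂ]
    Module.End ℂ (VertexOperator ℂ (VacuumModule Φ k)) :=
  UniversalEnvelopingAlgebra.lift ℂ (fieldRep Φ k)

theorem fieldAct_ι (x : AffineLie Φ) :
    fieldAct Φ k (UniversalEnvelopingAlgebra.ι ℂ x) =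
      fieldLin Φ k x :=
  UniversalEnvelopingAlgebra.lift_ι_apply ℂ (fieldRep Φ k) x

theorem fieldAct_idField (u : UniversalEnvelopingAlgebra ℂ (AffineLie Φ))
    (hu : u ∈ vacuumIdeal Φ k) : fieldAct Φ k u idField = 0 := by
  induction hu using Submodule.span_induction with
  | zero => rw [map_zero, LinearMap.zero_apply]
  | add x y _ _ hx hy => rw [map_add, LinearMap.add_apply, hx, hy, add_zero]
  | smul r x _ hx => rw [smul_eq_mul, map_mul, Module.End.mul_apply, hx, map_zero]
  | mem x hx =>
    rcases hx with ⟨a, n, hn, rfl⟩ | rfl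
    · rw [fieldAct_ι, fieldLin_loopElt, fieldMode_apply, nthProduct_idField_of_nonneg _ _ hn]
    · rw [map_sub, fieldAct_ι, fieldLin_centralElt, AlgHom.commutes, LinearMap.sub_apply,
        Module.algebraMap_end_apply, LinearMap.smul_apply, Module.End.one_apply, sub_self]

/-- The state-field correspondence `Y(·, z)` of the vertex operator algebra `V(k,0)`:
the unique linear map with `Y(𝟙, z) = id` and `Y(a(n)v, z) = a(z)_n Y(v, z)`. -/
def stateField : VacuumModule Φ k →ₗ[ℂ] VertexOperator ℂ (VacuumModule Φ k) :=
  ((vacuumIdeal Φ k).restrictScalars ℂ).liftQ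
    ((LinearMap.applyₗ (idField : VertexOperator ℂ (VacuumModule Φ k))).comp
      (fieldAct Φ k).toLinearMap) (fun u hu => fieldAct_idField Φ k u hu)

theorem stateField_mk (u : UniversalEnvelopingAlgebra ℂ (AffineLie Φ)) :
    stateField Φ k (Submodule.Quotient.mk u) = fieldAct Φ k u idField := rfl

theorem stateField_vacuum : stateField Φ k (vacuum Φ k) = idField := by
  rw [vacuum, stateField_mk, map_one, Module.End.one_apply]

theorem stateField_mode (a : 𝔤) (n : ℤ) (v : VacuumModule Φ k) :
    stateField Φ k (mode Φ k a n v) = nthProduct (currentField Φ k a) (stateField Φ k v) n := by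
  obtain ⟨u, rfl⟩ := Submodule.Quotient.mk_surjective _ v
  change stateField Φ k (Submodule.Quotient.mk
    (UniversalEnvelopingAlgebra.ι ℂ (loopElt Φ a n) * u)) = _
  rw [stateField_mk, stateField_mk, map_mul, Module.End.mul_apply, fieldAct_ι, fieldLin_loopElt,
    fieldMode_apply]

theorem stateField_current (a : 𝔤) :
    stateField Φ k (mode Φ k a (-1) (vacuum Φ k)) = currentField Φ k a := by
  rw [stateField_mode, stateField_vacuum, nthProduct_idField_neg_one]

/-- For `λ : 𝔥 → ℂ`, the weight space `V(k,0)(λ) = {v | h(0) v = λ(h) v for all h ∈ 𝔥}`. -/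
def weightSubspace (H : LieSubalgebra ℂ 𝔤) (lam : H → ℂ) : Submodule ℂ (VacuumModule Φ k) where
  carrier := {v | ∀ h : H, mode Φ k (h : 𝔤) 0 v = lam h • v}
  add_mem' hv hw h := by rw [map_add, hv h, hw h, smul_add]
  zero_mem' h := by rw [map_zero, smul_zero]
  smul_mem' r v hv h := by rw [map_smul, hv h, smul_comm]

/-- A vertex subalgebra of `V(k,0)`: a subspace that contains the vacuum vector and is closed under
all products `u_n v`, where `Y(u, z) = ∑ n, u_n z^(-n-1)`. -/
structure IsVertexSubalgebra (W : Submodule ℂ (VacuumModule Φ k)) : Prop where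
  vacuum_mem : vacuum Φ k ∈ W
  product_mem : ∀ u ∈ W, ∀ v ∈ W, ∀ n : ℤ, ncoeff (stateField Φ k u) n v ∈ W

/-- The vertex subalgebra of `V(k,0)` generated by a set: the smallest one containing the set. -/
def generatedSubalgebra (S : Set (VacuumModule Φ k)) : Submodule ℂ (VacuumModule Φ k) :=
  sInf {W | IsVertexSubalgebra Φ k W ∧ S ⊆ W}

end Affine

section Roots
open LieAlgebra.IsKilling

variable {𝔤 : Type*} [LieRing 𝔤] [LieAlgebra ℂ 𝔤] [FiniteDimensional ℂ 𝔤]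
  [LieAlgebra.IsKilling ℂ 𝔤] (H : LieSubalgebra ℂ 𝔤) [H.IsCartanSubalgebra]

/-- A long root: a root of maximal length, for the Weyl-invariant positive form of the root
system. -/
def IsLongRoot (α : H.root) : Prop :=
  ∀ β : H.root, ((rootSystem H).posRootForm ℤ).rootLength β ≤
    ((rootSystem H).posRootForm ℤ).rootLength α

end Roots

end AffineVOA

end

noncomputable section
namespace AffineVOA
-- Recovering products of modes from the n-th products of two fields.
section FieldAssociativity
open VertexOperator (ncoeff)
variable {R V : Type*} [CommRing R] [AddCommGroup V] [Module R V]

/-! Let U be the vertex subalgebra generated by the given vectors. The zero modes h(0) are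
derivations of all products (`mode_zero_ncoeff`), so the weight-zero space is a vertex subalgebra;
it contains the generators, hence U. The content is the reverse inclusion.

The simple roots span the dual of the Cartan subalgebra, so all h(n) preserve U
(`IsVertexSubalgebra.cartan_mode_mem`). Next come pairs of opposite root vectors. The iterate
formula for the modes of a(z)_n b(z) can be inverted (`ncoeff_ncoeff_mem`), so a(p)b(q) preserves U
as soon as every a(i)b(-1)𝟙 lies in U. For an sl₂-triple (h, e, f) put Q_m = f(-m)e(-1)𝟙. The
generator is Q_2, and h(1)Q_2 = -2Q_1. For m ≥ 2 the product (Q_2)_1 Q_m equals a positive multiple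
of Q_{m+1} modulo vectors already known to lie in U (`mode_f_succ_mem`), so all Q_m lie in U by
induction. The multiple cannot vanish because Φ(e, f)k ≥ 0, which follows from the normalization on
long roots (`exists_pos_form_eq`).

Finally, the weight-zero space is spanned by words a₁(n₁)⋯aₛ(nₛ)𝟙 in weight vectors of total weight
zero (`weightSubspace_le_span_word`), and letters may be permuted modulo shorter words. Induction on
length puts each such word in U (`word_mem_of_totalWeight_eq_zero`). If the first letter has root α,
pairing with the coroot of α produces another letter of weight β with β(α^∨) < 0. Unless β = -α,
that letter is a bracket [f, g] with f of weight -α, and a well-chosen mode of f replaces it: the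
word becomes x(p)f(M) applied to a shorter word of weight zero. -/

theorem sgnChoose_zero_right (n : ℤ) : sgnChoose n 0 = 1 := by
  simp [sgnChoose]

theorem sgnChoose_one_right (n : ℤ) : sgnChoose n 1 = -n := by
  simp [sgnChoose]

theorem sgnChoose_zero_left_succ (j : ℕ) : sgnChoose 0 (j + 1) = 0 := by
  simp [sgnChoose]

theorem sgnChoose_succ_right (n : ℤ) (j : ℕ) :
    sgnChoose n (j + 1) = sgnChoose (n - 1) (j + 1) - sgnChoose (n - 1) j := by
  have h := Ring.choose_succ_succ (n - 1) j
  rw [sub_add_cancel] at h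
  unfold sgnChoose
  rw [h, pow_succ]
  ring

theorem sgnChoose_neg_two (j : ℕ) : sgnChoose (-2) j = j + 1 := by
  induction j with
  | zero => simp [sgnChoose]
  | succ j ih =>
    have h1 : ∀ j, sgnChoose (-1) j = 1 := fun j => by
      have : Ring.choose (-1 : ℤ) j = (-1) ^ j := by
        rw [Ring.choose_neg', Ring.multichoose_one, Units.smul_def, Int.coe_negOnePow_natCast]
        simp
      rw [sgnChoose, this, ← mul_pow]
      simp
    have h := sgnChoose_succ_right (-1) j
    norm_num at h
    rw [h1, ih] at h
    push_cast
    linarith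

theorem finsum_eq_zero_add_succ {f : ℕ → V} (hf : f.HasFiniteSupport) :
    ∑ᶠ j, f j = f 0 + ∑ᶠ j, f (j + 1) := by
  obtain ⟨N, hN⟩ : ∃ N, ∀ j, N ≤ j → f j = 0 := by
    obtain ⟨N, hN⟩ := Set.Finite.bddAbove hf
    refine ⟨N + 1, fun j hj => ?_⟩
    by_contra h
    have := hN (Function.mem_support.mpr h)
    omega
  rw [finsum_eq_sum_of_support_subset (s := Finset.range (N + 1)),
    finsum_eq_sum_of_support_subset (s := Finset.range N), Finset.sum_range_succ', add_comm]
  · intro j hj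
    by_contra h
    exact hj (hN _ (by simp at h; omega))
  · intro j hj
    by_contra h
    exact hj (hN _ (by simp at h; omega))

/-- The coefficient of `B_{p+q-j} A_j` in the `L`-th iterated sum of iterate formulas. -/
def iterateCoeff (L : ℕ) (p : ℤ) (j : ℕ) : ℤ :=
  if j < L then 0 else (-1) ^ L * sgnChoose (p - L) (j - L)

/-- The numbers `iterateCoeff L p j` are the coefficients of (-z)^L (1-z)^(p-L), and the recursion
is the factorization (1-z)^(p-L) - (1-z)^(p-1-L) = -z (1-z)^(p-L-1). -/
theorem iterateCoeff_succ (L : ℕ) (p : ℤ) (j : ℕ) :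
    iterateCoeff (L + 1) p j = iterateCoeff L p j - iterateCoeff L (p - 1) j := by
  unfold iterateCoeff
  rcases lt_trichotomy j L with h | rfl | h
  · simp [h, Nat.lt_succ_of_lt h]
  · simp [sgnChoose_zero_right]
  · obtain ⟨i, rfl⟩ := Nat.exists_eq_add_of_lt h
    rw [if_neg (by omega), if_neg (by omega), if_neg (by omega),
      show L + i + 1 - (L + 1) = i by omega, show L + i + 1 - L = i + 1 by omega,
      sgnChoose_succ_right (p - L) i, pow_succ]
    push_cast
    rw [show p - ((L : ℤ) + 1) = p - L - 1 by ring, show p - 1 - (L : ℤ) = p - L - 1 by ring]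
    ring

/-- For L = 0 this is the iterate formula itself. Each further step adds the relations at (p, q) and
(p-1, q+1), which keeps the index sum p+q. The gain is that the first L terms B A_j disappear, while
the leading term A_p B_q keeps coefficient 1. -/
theorem iterate_sum_mem (A B : VertexOperator R V) (w : V) (S : Submodule R V)
    (hS : ∀ n m, ncoeff (nthProduct A B n) m w ∈ S) (L : ℕ) (p q : ℤ) :
    ∑ᶠ j : ℕ, sgnChoose (p - L) j • ncoeff A (p - j) (ncoeff B (q + j) w) -
      (p.negOnePow : ℤ) • ∑ᶠ j : ℕ, iterateCoeff L p j •
        ncoeff B (q + p - j) (ncoeff A j w) ∈ S := by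
  have hfA : ∀ p q : ℤ, (fun j : ℕ => ncoeff A (p - j) (ncoeff B (q + j) w)).HasFiniteSupport := by
    intro p q
    obtain ⟨N, hN⟩ := eventually_zero B w q
    refine Set.Finite.subset (Finset.finite_toSet (Finset.range N)) fun j hj => ?_
    by_contra h
    exact hj (by simp only [hN j (by simpa using h), map_zero])
  have hfB : ∀ s : ℤ, (fun j : ℕ => ncoeff B (s - j) (ncoeff A j w)).HasFiniteSupport := by
    intro s
    obtain ⟨N, hN⟩ := eventually_zero A w 0
    refine Set.Finite.subset (Finset.finite_toSet (Finset.range N)) fun j hj => ?_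
    by_contra h
    have := hN j (by simpa using h)
    rw [zero_add] at this
    exact hj (by simp only [this, map_zero])
  induction L generalizing p q with
  | zero =>
    have h := hS p q
    rw [ncoeff_nthProduct] at h
    convert h using 1
    simp only [smul_sub, iterateCoeff, not_lt_zero, if_false, pow_zero, one_mul, Nat.cast_zero,
      sub_zero, Nat.sub_zero]
    rw [finsum_sub_distrib (finite_zsmul (hfA p q) _)]
    · congr 1
      rw [smul_finsum' _ (finite_zsmul (hfB (q + p)) _)]
      exact finsum_congr fun j => smul_comm _ _ _
    · exact finite_zsmul (finite_zsmul (hfB (q + p)) _) _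
  | succ L ih =>
    have h := S.add_mem (ih p q) (ih (p - 1) (q + 1))
    convert h using 1
    -- Coefficientwise this is (1-z)^(p-L-1) = (1-z)^(p-L) + z(1-z)^(p-1-L); the shift by z is the
    -- passage to (p-1, q+1).
    have e1 : ∑ᶠ j : ℕ, sgnChoose (p - (L + 1 : ℕ)) j • ncoeff A (p - j) (ncoeff B (q + j) w) =
        ∑ᶠ j : ℕ, sgnChoose (p - L) j • ncoeff A (p - j) (ncoeff B (q + j) w) +
        ∑ᶠ j : ℕ, sgnChoose (p - 1 - L) j •
          ncoeff A (p - 1 - j) (ncoeff B (q + 1 + j) w) := by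
      rw [finsum_eq_zero_add_succ (finite_zsmul (hfA p q) _),
        finsum_eq_zero_add_succ (finite_zsmul (hfA p q) _), add_assoc, ← finsum_add_distrib]
      · simp only [sgnChoose_zero_right]
        congr 1
        refine finsum_congr fun j => ?_
        push_cast
        rw [sgnChoose_succ_right (p - L) j, show p - ((L : ℤ) + 1) = p - L - 1 by ring,
          show p - 1 - (L : ℤ) = p - L - 1 by ring, show p - 1 - (j : ℤ) = p - (j + 1) by ring,
          show q + 1 + (j : ℤ) = q + (j + 1) by ring, sub_smul]
        abel
      · exact (finite_zsmul (hfA p q) _).comp_of_injective (Nat.succ_injective)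
      · exact finite_zsmul (hfA (p - 1) (q + 1)) _
    have e2 : ∑ᶠ j : ℕ, iterateCoeff (L + 1) p j • ncoeff B (q + p - j) (ncoeff A j w) =
        ∑ᶠ j : ℕ, iterateCoeff L p j • ncoeff B (q + p - j) (ncoeff A j w) -
        ∑ᶠ j : ℕ, iterateCoeff L (p - 1) j • ncoeff B (q + p - j) (ncoeff A j w) := by
      rw [← finsum_sub_distrib (finite_zsmul (hfB _) _) (finite_zsmul (hfB _) _)]
      exact finsum_congr fun j => by rw [iterateCoeff_succ, sub_smul]
    rw [e1, e2, show q + 1 + (p - 1) = q + p by ring, Int.negOnePow_sub, Int.negOnePow_one]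
    simp only [mul_neg, mul_one, Units.val_neg, smul_sub, neg_smul]
    abel

/-- Products of modes of two fields lie in any subspace that contains all modes of all
`n`-th products. -/
theorem ncoeff_ncoeff_mem (A B : VertexOperator R V) (w : V) (S : Submodule R V)
    (hS : ∀ n m, ncoeff (nthProduct A B n) m w ∈ S) (p q : ℤ) :
    ncoeff A p (ncoeff B q w) ∈ S := by
  obtain ⟨L, hL⟩ := eventually_zero A w 0
  obtain ⟨N, hN⟩ := eventually_zero B w q
  simp only [zero_add] at hL
  -- Downward induction on the mode of B: beyond q+N it kills w, and the relation below expresses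
  -- A_p B_{q+i} w through terms with a larger mode of B.
  have key : ∀ d : ℕ, ∀ i : ℕ, N ≤ i + d → ∀ p, ncoeff A p (ncoeff B (q + i) w) ∈ S := by
    intro d
    induction d with
    | zero => intro i hi p; rw [hN i (by omega), map_zero]; exact S.zero_mem
    | succ d ih =>
      intro i hi p
      have h := iterate_sum_mem A B w S hS L p (q + i)
      -- L is chosen so that the coefficient vanishes for j < L and A_j w vanishes for j ≥ L.
      have e : ∑ᶠ j : ℕ, iterateCoeff L p j • ncoeff B (q + i + p - j) (ncoeff A j w) = 0 := by
        rw [← finsum_zero (α := ℕ)]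
        refine finsum_congr fun j => ?_
        by_cases hj : j < L
        · rw [iterateCoeff, if_pos hj, zero_smul]
        · rw [hL j (by omega), map_zero, smul_zero]
      rw [e, smul_zero, sub_zero, finsum_eq_zero_add_succ] at h
      · rw [sgnChoose_zero_right, one_smul] at h
        simp only [Nat.cast_zero, sub_zero, add_zero] at h
        refine (S.add_mem_iff_left (finsum_induction (· ∈ S) S.zero_mem
          (fun _ _ => S.add_mem) fun j => ?_)).mp h
        refine zsmul_mem ?_ _
        have := ih (i + (j + 1)) (by omega) (p - (j + 1 : ℕ))
        rwa [Nat.cast_add i (j + 1), ← add_assoc] at this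
      · refine Set.Finite.subset (Finset.finite_toSet (Finset.range N)) fun j hj => ?_
        by_contra hh
        refine hj ?_
        have := hN (i + j) (by simp at hh; omega)
        rw [Nat.cast_add i j, ← add_assoc] at this
        simp only [this, map_zero, smul_zero]
  simpa using key N 0 (by omega) p

theorem ncoeff_nthProduct_zero (A B : VertexOperator R V) (m : ℤ) (v : V) :
    ncoeff (nthProduct A B 0) m v = ncoeff A 0 (ncoeff B m v) - ncoeff B m (ncoeff A 0 v) := by
  rw [ncoeff_nthProduct, finsum_eq_single _ 0]
  · simp [sgnChoose_zero_right]
  · intro j hj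
    obtain ⟨i, rfl⟩ := Nat.exists_eq_succ_of_ne_zero hj
    rw [Nat.succ_eq_add_one, sgnChoose_zero_left_succ, zero_smul]

end FieldAssociativity

/-! ### Invariant forms, coroots and root strings in a simple Lie algebra. -/

section LieTheory
open LieAlgebra LieAlgebra.IsKilling LieModule

variable {𝔤 : Type*} [LieRing 𝔤] [LieAlgebra ℂ 𝔤] [FiniteDimensional ℂ 𝔤]

/-- An invariant form on a simple Lie algebra is a multiple of the Killing form. -/
theorem InvariantForm.exists_eq_smul_killingForm [IsSimple ℂ 𝔤] (Φ : InvariantForm 𝔤) :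
    ∃ c : ℂ, Φ.form = c • killingForm ℂ 𝔤 := by
  have hn : (killingForm ℂ 𝔤).Nondegenerate := killingForm_nondegenerate ℂ 𝔤
  have : Nontrivial 𝔤 := by
    have := IsSimple.non_abelian ℂ (L := 𝔤)
    by_contra h
    rw [not_nontrivial_iff_subsingleton] at h
    exact this ⟨fun x y => Subsingleton.elim _ _⟩
  -- A Schur argument: D compares Φ with the Killing form κ. For an eigenvalue c of D, the radical
  -- of Φ - cκ is a nonzero ideal, hence everything.
  let D : Module.End ℂ 𝔤 :=
    ((killingForm ℂ 𝔤).toDual hn).symm.toLinearMap ∘ₗ Φ.form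
  have hD : ∀ x y, killingForm ℂ 𝔤 (D x) y = Φ.form x y := fun x y =>
    LinearMap.BilinForm.apply_toDual_symm_apply (hB := hn) _ _
  obtain ⟨c, hc⟩ := Module.End.exists_eigenvalue D
  obtain ⟨x, hx⟩ := hc.exists_hasEigenvector
  refine ⟨c, ?_⟩
  let I : LieIdeal ℂ 𝔤 :=
    { LinearMap.ker (Φ.form - c • killingForm ℂ 𝔤) with
      lie_mem := fun {z m} hm => by
        change (Φ.form - c • killingForm ℂ 𝔤) m = 0 at hm
        change (Φ.form - c • killingForm ℂ 𝔤) ⁅z, m⁆ = 0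
        ext y
        have h1 := congrArg (fun f => f ⁅z, y⁆) hm
        have h2 := Φ.invariant z m y
        have h3 : killingForm ℂ 𝔤 ⁅z, m⁆ y = - killingForm ℂ 𝔤 m ⁅z, y⁆ := by
          rw [← lie_skew, map_neg, LinearMap.neg_apply, neg_inj]
          exact LieModule.traceForm_apply_lie_apply ℂ 𝔤 𝔤 m z y
        simp only [LinearMap.sub_apply, LinearMap.smul_apply, LinearMap.zero_apply,
          smul_eq_mul] at h1 ⊢
        rw [h2, h3]
        linear_combination -h1 }
  have hxI : x ∈ I := by
    change (Φ.form - c • killingForm ℂ 𝔤) x = 0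
    ext y
    rw [LinearMap.sub_apply, LinearMap.smul_apply, LinearMap.sub_apply, LinearMap.smul_apply,
      ← hD, hx.apply_eq_smul, map_smul, LinearMap.smul_apply, sub_self, LinearMap.zero_apply]
  have htop : I = ⊤ := by
    refine (eq_bot_or_eq_top I).resolve_left fun h => hx.2 ?_
    rw [h] at hxI
    exact hxI
  ext x y
  have hxI : x ∈ I := htop ▸ LieSubmodule.mem_top x
  change (Φ.form - c • killingForm ℂ 𝔤) x = 0 at hxI
  have := congrArg (fun f => f y) hxI
  exact sub_eq_zero.mp this

variable {H : LieSubalgebra ℂ 𝔤} [H.IsCartanSubalgebra]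

/-- The Killing form on the Cartan subalgebra is the sum of β ⊗ β over the roots, and each β(α^∨) is
an integer. So the value is a sum of squares of integers, with the term β = α contributing 4. -/
theorem exists_natCast_killingForm_coroot [IsKilling ℂ 𝔤] (α : H.root) :
    ∃ N : ℕ, 0 < N ∧ killingForm ℂ 𝔤 (coroot α.1) (coroot α.1) = N := by
  have h := congrArg (fun f => f (coroot α.1) (coroot α.1)) (restrict_killingForm_eq_sum (H := H))
  simp only [LinearMap.sum_apply, LinearMap.smulRight_apply, LinearMap.smul_apply,
    smul_eq_mul, LinearMap.BilinForm.restrict_apply] at h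
  let z : Weight ℂ H 𝔤 → ℤ := fun β => chainBotCoeff α.1 β - chainTopCoeff α.1 β
  have hz : ∀ β : Weight ℂ H 𝔤, β (coroot α.1) = z β := fun β => apply_coroot_eq_cast α.1 β
  refine ⟨∑ β ∈ H.root, (z β).natAbs ^ 2, ?_, ?_⟩
  · refine Finset.sum_pos' (fun _ _ => by positivity) ⟨α.1, α.2, ?_⟩
    have h2 := root_apply_coroot (H.isNonZero_coe_root α)
    rw [hz] at h2
    have : z α.1 ≠ 0 := by rintro h0; rw [h0] at h2; norm_num at h2
    positivity
  · refine h.trans ?_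
    push_cast
    refine Finset.sum_congr rfl fun β _ => ?_
    change β (coroot α.1) * β (coroot α.1) = _
    rw [hz, Nat.cast_natAbs, ← sq, ← Int.cast_pow, ← Int.cast_pow, sq_abs]

/-- With long roots normalized to square length `2`, dual root vectors of an `sl₂`-triple pair to
a positive number. -/
theorem exists_pos_form_eq [IsSimple ℂ 𝔤] (Φ : InvariantForm 𝔤)
    (t : H.root → H) (ht : ∀ (α : H.root) (h : H), Φ.form (t α) h = α.1 h)
    (hlong : ∀ α : H.root, IsLongRoot H α → Φ.form (t α) (t α) = 2) (α : H.root)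
    {h e f : 𝔤} (hef : IsSl2Triple h e f) (he : e ∈ rootSpace H α.1)
    (hf : f ∈ rootSpace H (-α.1 : H → ℂ)) :
    ∃ r : ℝ, 0 < r ∧ Φ.form e f = r := by
  obtain ⟨c, hc⟩ := Φ.exists_eq_smul_killingForm
  have hc' : ∀ x y, Φ.form x y = c * killingForm ℂ 𝔤 x y := fun x y => by rw [hc]; rfl
  obtain ⟨γ, hγ⟩ : ∃ γ : H.root, IsLongRoot H γ := by
    have : Nonempty H.root := ⟨α⟩
    obtain ⟨γ, hγ⟩ := Finite.exists_max fun β => ((rootSystem H).posRootForm ℤ).rootLength β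
    exact ⟨γ, hγ⟩
  obtain ⟨N, hN0, hN⟩ := exists_natCast_killingForm_coroot γ
  obtain ⟨M, hM0, hM⟩ := exists_natCast_killingForm_coroot α
  have hγ0 := H.isNonZero_coe_root γ
  -- Both κ(γ^∨, γ^∨) and κ(γ^∨, t_γ) equal 4/s, since γ takes the value 2 on γ^∨ and on t_γ. Hence
  -- cN = Φ(γ^∨, t_γ) = γ(γ^∨) = 2.
  have hcN : c * N = 2 := by
    set s := γ.1 ((cartanEquivDual H).symm γ.1)
    have h1 : killingForm ℂ 𝔤 (coroot γ.1) (coroot γ.1) = 2 * (s⁻¹ * γ.1 (coroot γ.1)) := by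
      have := traceForm_coroot γ.1 (coroot γ.1)
      rw [nsmul_eq_mul, smul_eq_mul] at this
      exact this
    have h2 : killingForm ℂ 𝔤 (coroot γ.1) (t γ) = 2 * (s⁻¹ * γ.1 (t γ)) := by
      have := traceForm_coroot γ.1 (t γ)
      rw [nsmul_eq_mul, smul_eq_mul] at this
      exact this
    have h3 : γ.1 (t γ) = 2 := by rw [← ht, hlong γ hγ]
    have h4 : c * killingForm ℂ 𝔤 (coroot γ.1) (t γ) = 2 := by
      rw [← hc', Φ.symm.eq, ht, root_apply_coroot hγ0]
    rw [root_apply_coroot hγ0] at h1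
    rw [h3] at h2
    rw [← hN, h1, ← h2, h4]
  have hh := hef.h_eq_coroot (H.isNonZero_coe_root α) he hf
  -- Invariance gives Φ(h, h) = Φ([e, f], h) = 2Φ(e, f), and h is the coroot of α. Together with cN
  -- = 2 this yields Φ(e, f) = M/N.
  have h5 : 2 * Φ.form e f = c * M := by
    rw [← hM, ← hh, ← hc']
    nth_rw 1 [← hef.lie_e_f]
    have h6 := Φ.invariant e f h
    rw [h6, ← lie_skew, hef.lie_h_e_smul ℂ, map_neg, map_smul, Φ.symm.eq]
    simp
  have hN0' : (N : ℂ) ≠ 0 := by exact_mod_cast hN0.ne'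
  refine ⟨M / N, by positivity, ?_⟩
  have : Φ.form e f * 2 * N = M * 2 := by
    rw [mul_comm _ (2 : ℂ), h5, mul_right_comm, hcN, mul_comm]
  push_cast
  rw [eq_div_iff hN0']
  linear_combination this / 2

theorem mem_span_of_mem_rootSpace [IsKilling ℂ 𝔤] (β : Weight ℂ H 𝔤) (hβ : β.IsNonZero) {x y : 𝔤}
    (hx : x ∈ rootSpace H β) (hx0 : x ≠ 0) (hy : y ∈ rootSpace H β) : ∃ c : ℂ, y = c • x := by
  have h1 := finrank_rootSpace_eq_one β hβ
  obtain ⟨c, hc⟩ := (finrank_eq_one_iff_of_nonzero' (⟨x, hx⟩ : rootSpace H β)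
    (fun h => hx0 (congrArg Subtype.val h))).mp h1 ⟨y, hy⟩
  exact ⟨c, (congrArg Subtype.val hc).symm⟩

/-- If `β(α^∨) < 0`, every vector of weight `β` is in the image of `f_α`. -/
theorem exists_lie_eq_of_apply_coroot_neg [IsKilling ℂ 𝔤] (α : H.root) {h e f : 𝔤}
    (hef : IsSl2Triple h e f) (he : e ∈ rootSpace H α.1) (hf : f ∈ rootSpace H (-α.1 : H → ℂ))
    (β : Weight ℂ H 𝔤) (hβ : β.IsNonZero) (z : ℤ) (hz : z < 0) (hβz : β (coroot α.1) = z)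
    {y : 𝔤} (hy : y ∈ rootSpace H β) :
    ∃ x ∈ rootSpace H (α.1 + β : H → ℂ), y = ⁅f, x⁆ := by
  have hh := hef.h_eq_coroot (H.isNonZero_coe_root α) he hf
  obtain ⟨y', hy', hy0⟩ := (-β).exists_ne_zero
  have hfy : ⁅f, y'⁆ ≠ 0 := by
    intro h0
    -- For the opposite triple (-h, f, e), a vector of weight -β killed by f would be primitive of
    -- weight z < 0, whereas primitive weights in finite dimension are natural numbers.
    have P : hef.symm.HasPrimitiveVectorWith y' (z : ℂ) :=
      { ne_zero := hy0
        lie_h := by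
          have := lie_eq_smul_of_mem_rootSpace hy' (coroot α.1)
          rw [H.coe_bracket_of_module, ← hh] at this
          rw [neg_lie, this, Weight.coe_neg, Pi.neg_apply, hβz, neg_smul, neg_neg]
        lie_e := h0 }
    obtain ⟨n, hn⟩ := P.exists_nat
    have : z = n := by exact_mod_cast hn
    omega
  have hmem : ⁅f, y'⁆ ∈ rootSpace H (-(α.1 + β : H → ℂ)) := by
    have := lie_mem_genWeightSpace_of_mem_genWeightSpace hf hy'
    rwa [Weight.coe_neg, ← neg_add] at this
  -- Duality turns injectivity of ad f on weight -β into surjectivity onto weight β: κ([f, y'], x) =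
  -- -κ(y', [f, x]), so [f, x] is nonzero in a one-dimensional root space.
  obtain ⟨x, hx, hx0⟩ : ∃ x ∈ rootSpace H (α.1 + β : H → ℂ), killingForm ℂ 𝔤 ⁅f, y'⁆ x ≠ 0 := by
    by_contra! hcon
    refine hfy ?_
    simpa using mem_ker_killingForm_of_mem_rootSpace_of_forall_rootSpace_neg ℂ 𝔤 H hmem
      (by rwa [neg_neg])
  have hfx : ⁅f, x⁆ ∈ rootSpace H β := by
    have := lie_mem_genWeightSpace_of_mem_genWeightSpace hf hx
    rwa [neg_add_cancel_left] at this
  have hfx0 : ⁅f, x⁆ ≠ 0 := by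
    intro h0
    apply hx0
    rw [← lie_skew, map_neg, LinearMap.neg_apply, LieModule.traceForm_apply_lie_apply, h0,
      map_zero, neg_zero]
  obtain ⟨c, hc⟩ := mem_span_of_mem_rootSpace β hβ hfx hfx0 hy
  exact ⟨c • x, (rootSpace H _).smul_mem c hx, by rw [lie_smul, hc]⟩

theorem InvariantForm.apply_eq_zero_of_add_ne_zero [IsSimple ℂ 𝔤] (Φ : InvariantForm 𝔤)
    {α β : H → ℂ} {x y : 𝔤} (hx : x ∈ rootSpace H α) (hy : y ∈ rootSpace H β)
    (h : α + β ≠ 0) : Φ.form x y = 0 := by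
  obtain ⟨c, hc⟩ := Φ.exists_eq_smul_killingForm
  rw [hc, LinearMap.smul_apply, LinearMap.smul_apply,
    killingForm_apply_eq_zero_of_mem_rootSpace_of_add_ne_zero ℂ 𝔤 H hx hy h, smul_zero]

/-- The vectors representing the simple roots span the Cartan subalgebra. -/
theorem mem_span_image_support [IsSimple ℂ 𝔤] (b : (rootSystem H).Base) (Φ : InvariantForm 𝔤)
    (hΦ : Φ.form.Nondegenerate)
    (t : H.root → H) (ht : ∀ (α : H.root) (h : H), Φ.form (t α) h = α.1 h) (h : H) :
    h ∈ Submodule.span ℂ (t '' b.support) := by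
  obtain ⟨c, hc⟩ := Φ.exists_eq_smul_killingForm
  let F : H →ₗ[ℂ] Module.Dual ℂ H := Φ.form.restrict H
  have hF : Function.Injective F := by
    rw [injective_iff_map_eq_zero]
    intro x hx
    -- If c = 0 the form Φ is zero, and nondegeneracy forces x = 0. Otherwise the Killing form is
    -- nondegenerate on the Cartan subalgebra.
    by_cases hc0 : c = 0
    · refine Subtype.ext (hΦ.1 x fun y => ?_)
      rw [hc, hc0, zero_smul, LinearMap.zero_apply, LinearMap.zero_apply]
    · have h1 : x ∈ LinearMap.ker (LieModule.traceForm ℂ H 𝔤) := by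
        rw [LinearMap.mem_ker]
        ext y
        have h2 : Φ.form x y = 0 := congrArg (fun f => f y) hx
        rw [hc] at h2
        exact (mul_eq_zero.mp h2).resolve_left hc0
      simpa using h1
  have h1 : F h ∈ Submodule.span ℂ ((rootSystem H).root '' b.support) := by
    rw [b.span_root_support]
    have := RootPairing.IsRootSystem.span_root_eq_top (P := rootSystem H)
    change F h ∈ Submodule.span ℂ (Set.range (rootSystem H).root)
    rw [this]
    exact Submodule.mem_top
  have h2 : (rootSystem H).root '' b.support = F '' (t '' b.support) := by
    rw [Set.image_image]
    refine Set.image_congr fun α _ => ?_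
    ext h
    exact (ht α h).symm
  rw [h2, Submodule.span_image] at h1
  obtain ⟨h', hh', e⟩ := h1
  exact hF e ▸ hh'

end LieTheory

/-! ### Closure properties of vertex subalgebras of V(k,0). -/

section VertexSubalgebra
open VertexOperator (ncoeff)
open LieAlgebra

variable {𝔤 : Type*} [LieRing 𝔤] [LieAlgebra ℂ 𝔤] (Φ : InvariantForm 𝔤) (k : ℂ)

theorem mode_add (a b : 𝔤) (n : ℤ) (v : VacuumModule Φ k) :
    mode Φ k (a + b) n v = mode Φ k a n v + mode Φ k b n v := by
  simp only [mode_apply, loopElt_add, map_add, add_smul]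

theorem mode_smul (r : ℂ) (a : 𝔤) (n : ℤ) (v : VacuumModule Φ k) :
    mode Φ k (r • a) n v = r • mode Φ k a n v := by
  simp only [mode_apply, loopElt_smul, map_smul, smul_assoc]

theorem mode_zero_left (n : ℤ) (v : VacuumModule Φ k) : mode Φ k (0 : 𝔤) n v = 0 := by
  simpa using mode_smul Φ k 0 (0 : 𝔤) n v

theorem mode_mode (a b : 𝔤) (m n : ℤ) (v : VacuumModule Φ k) :
    mode Φ k a m (mode Φ k b n v) = mode Φ k b n (mode Φ k a m v) +
      mode Φ k ⁅a, b⁆ (m + n) v + (if m + n = 0 then (m : ℂ) * (Φ.form a b * k) else 0) • v := by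
  rw [add_assoc, ← mode_comm, add_sub_cancel]

/-- The zero mode of a current is a derivation of all products. -/
theorem mode_zero_ncoeff (a : 𝔤) (u v : VacuumModule Φ k) (n : ℤ) :
    mode Φ k a 0 (ncoeff (stateField Φ k u) n v) =
      ncoeff (stateField Φ k (mode Φ k a 0 u)) n v +
        ncoeff (stateField Φ k u) n (mode Φ k a 0 v) := by
  rw [stateField_mode, ncoeff_nthProduct_zero, ncoeff_currentField, ncoeff_currentField,
    sub_add_cancel]

theorem isVertexSubalgebra_weightSubspace_zero (H : LieSubalgebra ℂ 𝔤) :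
    IsVertexSubalgebra Φ k (weightSubspace Φ k H 0) where
  vacuum_mem h := by rw [mode_vacuum _ _ _ _ le_rfl, Pi.zero_apply, zero_smul]
  product_mem u hu v hv n h := by
    rw [mode_zero_ncoeff, hu h, hv h]
    simp

theorem isVertexSubalgebra_generatedSubalgebra (S : Set (VacuumModule Φ k)) :
    IsVertexSubalgebra Φ k (generatedSubalgebra Φ k S) where
  vacuum_mem := (Submodule.mem_sInf).mpr fun _ hW => hW.1.vacuum_mem
  product_mem u hu v hv n := (Submodule.mem_sInf).mpr fun W hW =>
    hW.1.product_mem u (Submodule.mem_sInf.mp hu W hW) v (Submodule.mem_sInf.mp hv W hW) n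

theorem subset_generatedSubalgebra (S : Set (VacuumModule Φ k)) :
    S ⊆ generatedSubalgebra Φ k S :=
  fun _ hx => (Submodule.mem_sInf).mpr fun _ hW => hW.2 hx

variable {Φ k} {U : Submodule ℂ (VacuumModule Φ k)}

theorem IsVertexSubalgebra.mode_mem (hU : IsVertexSubalgebra Φ k U) {a : 𝔤}
    (ha : mode Φ k a (-1) (vacuum Φ k) ∈ U) (n : ℤ) {v : VacuumModule Φ k} (hv : v ∈ U) :
    mode Φ k a n v ∈ U := by
  have := hU.product_mem _ ha v hv n
  rwa [stateField_current, ncoeff_currentField] at this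

/-- The fields a(z)_i b(z) belong to the states a(i)b(-1)𝟙, so `ncoeff_ncoeff_mem` applies with S =
U. The pair a(p)b(q) thus acts on U even when neither current on its own does. -/
theorem IsVertexSubalgebra.mode_mode_mem (hU : IsVertexSubalgebra Φ k U) {a b : 𝔤}
    (hab : ∀ i, mode Φ k a i (mode Φ k b (-1) (vacuum Φ k)) ∈ U) (p q : ℤ)
    {v : VacuumModule Φ k} (hv : v ∈ U) : mode Φ k a p (mode Φ k b q v) ∈ U := by
  have := ncoeff_ncoeff_mem (currentField Φ k a) (currentField Φ k b) v U (fun n m => by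
    have := hU.product_mem _ (hab n) v hv m
    rwa [stateField_mode, stateField_current] at this) p q
  rwa [ncoeff_currentField, ncoeff_currentField] at this

/-- Translating `a(-m)b(-1)𝟙`. -/
theorem IsVertexSubalgebra.mode_mode_neg_two_mem (hU : IsVertexSubalgebra Φ k U) {a b : 𝔤} (m : ℕ)
    (hq : mode Φ k a (-m) (mode Φ k b (-1) (vacuum Φ k)) ∈ U) :
    mode Φ k a (-m) (mode Φ k b (-2) (vacuum Φ k)) +
      (m : ℂ) • mode Φ k a (-(m + 1 : ℕ)) (mode Φ k b (-1) (vacuum Φ k)) ∈ U := by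
  -- The product u_{-2}𝟙 is the translate of u. In the iterate formula only j = 0, 1 survive,
  -- because b(-2+j) kills the vacuum for j ≥ 2 and so does a(j) for every j.
  have h1 := hU.product_mem _ hq _ hU.vacuum_mem (-2)
  rw [stateField_mode, stateField_current, ncoeff_nthProduct,
    finsum_eq_sum_of_support_subset (s := Finset.range 2)] at h1
  · simp only [Finset.sum_range_succ, Finset.sum_range_zero, sgnChoose_zero_right,
      sgnChoose_one_right, ncoeff_currentField, zero_add] at h1
    rw [mode_vacuum _ _ a _ (by positivity), mode_vacuum _ _ a _ (by positivity)] at h1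
    convert h1 using 1
    simp only [map_zero, smul_zero, sub_zero, one_smul, neg_neg, Nat.cast_zero, add_zero,
      Nat.cast_one, Nat.cast_smul_eq_nsmul]
    congr 4
    · push_cast; ring
  · intro j hj
    by_contra hj2
    have hj3 : 1 < j := by simpa using hj2
    apply hj
    simp only [ncoeff_currentField]
    rw [mode_vacuum _ _ a _ (by positivity), mode_vacuum _ _ b _ (by omega)]
    simp

end VertexSubalgebra

/-! ### The sl₂ computation: from f(-2)e(-1)𝟙 to all f(-m)e(-1)𝟙. -/

section SlTwo
open VertexOperator (ncoeff)
open LieAlgebra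

variable {𝔤 : Type*} [LieRing 𝔤] [LieAlgebra ℂ 𝔤] {Φ : InvariantForm 𝔤} {k : ℂ} {h e f : 𝔤}

theorem InvariantForm.apply_self_of_lie_eq_smul {Φ : InvariantForm 𝔤} {x : 𝔤} {c : ℂ} (hc : c ≠ 0)
    (hx : ⁅h, x⁆ = c • x) : Φ.form x x = 0 := by
  have := Φ.invariant h x x
  rw [hx, map_smul, map_smul, LinearMap.smul_apply, smul_eq_mul] at this
  have h2 : c * Φ.form x x = 0 := by linear_combination this / 2
  exact (mul_eq_zero.mp h2).resolve_left hc

theorem InvariantForm.apply_left_of_lie_eq_smul {Φ : InvariantForm 𝔤} {x : 𝔤} {c : ℂ} (hc : c ≠ 0)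
    (hx : ⁅h, x⁆ = c • x) : Φ.form h x = 0 := by
  have := Φ.invariant h h x
  rw [hx, lie_self, map_zero, map_smul, LinearMap.zero_apply, zero_eq_neg, smul_eq_mul] at this
  exact (mul_eq_zero.mp this).resolve_left hc

variable (t : IsSl2Triple h e f)
include t

theorem mode_e_mode_f (p q : ℤ) (v : VacuumModule Φ k) :
    mode Φ k e p (mode Φ k f q v) = mode Φ k f q (mode Φ k e p v) + mode Φ k h (p + q) v +
      (if p + q = 0 then (p : ℂ) * (Φ.form e f * k) else 0) • v := by
  rw [mode_mode, t.lie_e_f]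

theorem mode_h_mode_f (p q : ℤ) (v : VacuumModule Φ k) :
    mode Φ k h p (mode Φ k f q v) =
      mode Φ k f q (mode Φ k h p v) - (2 : ℂ) • mode Φ k f (p + q) v := by
  have hl : ⁅h, f⁆ = (-2 : ℂ) • f := by rw [t.lie_lie_smul_f ℂ, neg_smul]
  rw [mode_mode, hl, mode_smul, Φ.apply_left_of_lie_eq_smul (by norm_num) hl]
  simp [sub_eq_add_neg]

theorem mode_h_mode_e (p q : ℤ) (v : VacuumModule Φ k) :
    mode Φ k h p (mode Φ k e q v) =
      mode Φ k e q (mode Φ k h p v) + (2 : ℂ) • mode Φ k e (p + q) v := by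
  have hl : ⁅h, e⁆ = (2 : ℂ) • e := t.lie_h_e_smul ℂ
  rw [mode_mode, hl, mode_smul, Φ.apply_left_of_lie_eq_smul (by norm_num) hl]
  simp

theorem mode_e_mode_e (p q : ℤ) (v : VacuumModule Φ k) :
    mode Φ k e p (mode Φ k e q v) = mode Φ k e q (mode Φ k e p v) := by
  have hl : ⁅h, e⁆ = (2 : ℂ) • e := t.lie_h_e_smul ℂ
  rw [mode_mode, lie_self, mode_zero_left, Φ.apply_self_of_lie_eq_smul (by norm_num) hl]
  simp

theorem mode_f_mode_f (p q : ℤ) (v : VacuumModule Φ k) :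
    mode Φ k f p (mode Φ k f q v) = mode Φ k f q (mode Φ k f p v) := by
  have hl : ⁅h, f⁆ = (-2 : ℂ) • f := by rw [t.lie_lie_smul_f ℂ, neg_smul]
  rw [mode_mode, lie_self, mode_zero_left, Φ.apply_self_of_lie_eq_smul (by norm_num) hl]
  simp

variable {U : Submodule ℂ (VacuumModule Φ k)} (hU : IsVertexSubalgebra Φ k U)
  (hh : mode Φ k h (-1) (vacuum Φ k) ∈ U)
include hU hh

/-- The nonnegative modes of `f` on `e(-1)𝟙`. -/
theorem mode_f_nonneg_mem (i : ℤ) (hi : 0 ≤ i) :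
    mode Φ k f i (mode Φ k e (-1) (vacuum Φ k)) ∈ U := by
  have h1 := mode_e_mode_f (Φ := Φ) (k := k) t (-1) i (vacuum Φ k)
  rw [mode_vacuum _ _ f i hi, map_zero, add_assoc] at h1
  rw [eq_neg_of_add_eq_zero_left h1.symm]
  exact U.neg_mem (U.add_mem (hU.mode_mem hh _ hU.vacuum_mem) (U.smul_mem _ hU.vacuum_mem))

/-- Translation of f(-m)e(-1)𝟙, followed by exchanging f(-m) and e(-2) at the cost of a Cartan mode
on the vacuum. With Q_m = f(-m)e(-1)𝟙 it reads e(-2)f(-m)𝟙 ≡ -m Q_{m+1} modulo U. -/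
theorem mode_e_neg_two_mode_f_mem (m : ℕ)
    (hq : mode Φ k f (-m) (mode Φ k e (-1) (vacuum Φ k)) ∈ U) :
    mode Φ k e (-2) (mode Φ k f (-m) (vacuum Φ k)) +
      (m : ℂ) • mode Φ k f (-(m + 1 : ℕ)) (mode Φ k e (-1) (vacuum Φ k)) ∈ U := by
  have h1 := hU.mode_mode_neg_two_mem m hq
  rw [mode_e_mode_f t, if_neg (by omega), zero_smul, add_zero, add_right_comm]
  exact U.add_mem h1 (hU.mode_mem hh _ hU.vacuum_mem)

/-- The terms `f(-2-j)e(1+j)` in the action of `f(-2)e(-1)𝟙` on `f(-m)e(-1)𝟙`. -/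
theorem mode_f_mode_e_sub_mem (m j : ℕ) (hj : j < m)
    (hq : ∀ i : ℕ, 1 ≤ i → i ≤ m → mode Φ k f (-i) (mode Φ k e (-1) (vacuum Φ k)) ∈ U) :
    mode Φ k f (-2 - j) (mode Φ k e (1 + j)
      (mode Φ k f (-m) (mode Φ k e (-1) (vacuum Φ k)))) -
      (2 + if j + 1 = m then (m : ℂ) * (Φ.form e f * k) else 0) •
        mode Φ k f (-(m + 1 : ℕ)) (mode Φ k e (-1) (vacuum Φ k)) ∈ U := by
  set v1 := mode Φ k e (-1) (vacuum Φ k) with hv1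
  have e1 : mode Φ k e (1 + j) v1 = 0 := by
    rw [hv1, mode_e_mode_e t, mode_vacuum _ _ e _ (by positivity), map_zero]
  have e2 := mode_h_mode_f (Φ := Φ) (k := k) t (1 + j + -m) (-2 - j) v1
  rw [show (1 : ℤ) + j + -m + (-2 - j) = -(m + 1 : ℕ) by push_cast; ring] at e2
  rw [mode_e_mode_f t, e1, map_zero, zero_add, map_add, map_smul, eq_add_of_sub_eq e2.symm]
  -- Moving f(-2-j) past the Cartan mode h(1+j-m) always yields 2Q_{m+1}. For j+1 = m the remaining
  -- h(0)Q_{m+1} is zero by weight and the central term appears; for j+1 < m the remainder is a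
  -- Cartan mode on Q_{j+2}, which is in U since j+2 ≤ m.
  by_cases hjm : j + 1 = m
  · subst hjm
    have e3 : mode Φ k h 0 v1 = (2 : ℂ) • v1 := by
      rw [hv1, mode_h_mode_e t, mode_vacuum _ _ h _ le_rfl, map_zero, zero_add, zero_add]
    have e4 := mode_h_mode_f (Φ := Φ) (k := k) t 0 (-(j + 1 + 1 : ℕ)) v1
    rw [e3, map_smul, zero_add, sub_self] at e4
    rw [if_pos (by push_cast; ring), if_pos rfl,
      show (1 : ℤ) + j + -(j + 1 : ℕ) = 0 by push_cast; ring,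
      show (-2 - j : ℤ) = -(j + 1 + 1 : ℕ) by push_cast; ring, e4]
    convert U.zero_mem
    push_cast
    module
  · rw [if_neg (by omega), if_neg hjm, zero_smul, add_zero, add_zero, add_sub_cancel_right]
    refine hU.mode_mem hh _ ?_
    have := hq (j + 2) (by omega) (by omega)
    rwa [show (-2 - j : ℤ) = -(j + 2 : ℕ) by push_cast; ring]

/-- The terms `e(-1-j)f(j)` in the action of `f(-2)e(-1)𝟙` on `f(-m)e(-1)𝟙`. -/
theorem mode_e_mode_f_sub_mem (m j : ℕ) (hm : 1 ≤ m)
    (hq : mode Φ k f (-m) (mode Φ k e (-1) (vacuum Φ k)) ∈ U) :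
    mode Φ k e (-1 - j) (mode Φ k f j
      (mode Φ k f (-m) (mode Φ k e (-1) (vacuum Φ k)))) +
      (if j = 0 then 2 * (m : ℂ) + 2 else if j = 1 then (m : ℂ) * (Φ.form e f * k) else 0) •
        mode Φ k f (-(m + 1 : ℕ)) (mode Φ k e (-1) (vacuum Φ k)) ∈ U := by
  have h2 := mode_e_neg_two_mode_f_mem t hU hh m hq
  have e1 : mode Φ k f j (mode Φ k e (-1) (vacuum Φ k)) =
      -mode Φ k h (-1 + j) (vacuum Φ k) +
        (if j = 1 then Φ.form e f * k else 0) • vacuum Φ k := by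
    have := mode_e_mode_f (Φ := Φ) (k := k) t (-1) j (vacuum Φ k)
    rw [mode_vacuum _ _ f _ (by positivity), map_zero, add_assoc] at this
    rw [eq_neg_of_add_eq_zero_left this.symm, neg_add, ← neg_smul]
    congr 2
    by_cases hj : j = 1
    · subst hj; simp
    · rw [if_neg hj, if_neg (by omega), neg_zero]
  rw [mode_f_mode_f t, e1]
  -- For j = 0 the vector is -e(-1)f(-m)h(-1)𝟙: moving h(-1) left past f(-m) gives -2Q_{m+1}, and
  -- past e(-1) gives 2e(-2)f(-m)𝟙 ≡ -2m Q_{m+1}. For j = 1 only the central term survives, and for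
  -- j ≥ 2 nothing does.
  rcases j with _ | _ | j
  · rw [if_neg (by omega), if_pos rfl, zero_smul, add_zero, Nat.cast_zero, sub_zero, add_zero,
      map_neg, map_neg]
    have e2 := mode_h_mode_f (Φ := Φ) (k := k) t (-1) (-m) (vacuum Φ k)
    rw [show (-1 + -m : ℤ) = -(m + 1 : ℕ) by push_cast; ring] at e2
    have e3 := mode_h_mode_e (Φ := Φ) (k := k) t (-1) (-1) (mode Φ k f (-m) (vacuum Φ k))
    have e4 := mode_e_mode_f (Φ := Φ) (k := k) t (-1) (-m) (vacuum Φ k)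
    have e5 := mode_e_mode_f (Φ := Φ) (k := k) t (-1) (-(m + 1 : ℕ)) (vacuum Φ k)
    rw [if_neg (by omega), zero_smul, add_zero] at e4 e5
    rw [eq_add_of_sub_eq e2.symm, map_add, map_smul, e5, eq_sub_of_add_eq e3.symm, e4]
    have m1 := hU.mode_mem hh (-1) (U.add_mem hq (hU.mode_mem hh (-1 + -m) hU.vacuum_mem))
    have m2 := hU.mode_mem hh (-1 + -(m + 1 : ℕ)) hU.vacuum_mem
    convert U.add_mem (U.neg_mem m1) (U.add_mem (U.smul_mem 2 h2) (U.smul_mem (-2) m2)) using 1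
    rw [show (-1 + -1 : ℤ) = -2 by norm_num]
    module
  · simp only [zero_add, Nat.cast_one, Int.reduceNeg, Int.reduceSub, neg_add_cancel, if_true,
      one_ne_zero, if_false]
    rw [mode_vacuum _ _ h _ le_rfl, neg_zero, zero_add, map_smul, map_smul]
    convert U.smul_mem (Φ.form e f * k) h2 using 1
    module
  · rw [if_neg (by omega), if_neg (by omega), if_neg (by omega), mode_vacuum _ _ h _ (by omega)]
    simp

/-- The product (Q_2)_1 Q_m lies in U and has the conformal degree of Q_{m+1}. The two preceding
lemmas evaluate it term by term as a combination of Q_{m+1} modulo U. All contributions have the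
same sign, so the total coefficient is nonzero. -/
theorem mode_f_succ_mem (r : ℝ) (hr : 0 ≤ r) (hef : Φ.form e f * k = r) (m : ℕ) (hm : 2 ≤ m)
    (hq : ∀ i : ℕ, 1 ≤ i → i ≤ m → mode Φ k f (-i) (mode Φ k e (-1) (vacuum Φ k)) ∈ U) :
    mode Φ k f (-(m + 1 : ℕ)) (mode Φ k e (-1) (vacuum Φ k)) ∈ U := by
  set Q := mode Φ k f (-(m + 1 : ℕ)) (mode Φ k e (-1) (vacuum Φ k)) with hQ
  set X := fun j : ℕ => mode Φ k f (-2 - j) (mode Φ k e (1 + j)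
      (mode Φ k f (-m) (mode Φ k e (-1) (vacuum Φ k))))
  set Y := fun j : ℕ => mode Φ k e (-1 - j) (mode Φ k f j
      (mode Φ k f (-m) (mode Φ k e (-1) (vacuum Φ k))))
  -- The coefficient of Q_{m+1} in X_j - Y_j; the constant 2 keeps it strictly positive for every j,
  -- even when r = 0.
  set c := fun j : ℕ => (2 + if j + 1 = m then (m : ℝ) * r else 0) +
    (if j = 0 then 2 * (m : ℝ) + 2 else if j = 1 then (m : ℝ) * r else 0)
  have hc : ∀ j, 0 < c j := fun j => by
    simp only [c]
    split_ifs <;> positivity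
  have h1 : ∑ j ∈ Finset.range m, ((j : ℂ) + 1) • (X j - Y j) ∈ U := by
    have hw : mode Φ k f (-2) (mode Φ k e (-1) (vacuum Φ k)) ∈ U := hq 2 (by omega) hm
    have := hU.product_mem _ hw _ (hq m (by omega) le_rfl) 1
    rw [stateField_mode, stateField_current, ncoeff_nthProduct,
      finsum_eq_sum_of_support_subset (s := Finset.range m)] at this
    · convert this using 1
      refine Finset.sum_congr rfl fun j _ => ?_
      rw [sgnChoose_neg_two, ncoeff_currentField, ncoeff_currentField, ncoeff_currentField,
        ncoeff_currentField, show ((-2 : ℤ).negOnePow : ℤ) = 1 by decide, one_smul,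
        show (1 + -2 - j : ℤ) = -1 - j by ring, ← Int.cast_smul_eq_zsmul ℂ]
      push_cast
      rfl
    -- The iterate sum stops at m: for j ≥ m ≥ 2 both e(1+j) and f(j) annihilate Q_m.
    · intro j hj
      by_contra hj2
      have hj3 : m ≤ j := by simpa using hj2
      apply hj
      simp only [ncoeff_currentField]
      have z1 := mode_e_mode_f (Φ := Φ) (k := k) t (1 + j) (-m)
        (mode Φ k e (-1) (vacuum Φ k))
      rw [mode_e_mode_e t (1 + j) (-1), mode_vacuum _ _ e (1 + j) (by positivity), mode_h_mode_e t,
        mode_vacuum _ _ h _ (by omega),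
        mode_vacuum _ _ e (1 + j + -m + -1) (by omega), if_neg (by omega)] at z1
      have z2 := mode_e_mode_f (Φ := Φ) (k := k) t (-1) j (vacuum Φ k)
      rw [mode_vacuum _ _ f _ (by positivity), mode_vacuum _ _ h _ (by omega),
        if_neg (by omega)] at z2
      simp only [map_zero, zero_smul, smul_zero, add_zero] at z1 z2
      rw [z1, mode_f_mode_f t, ← z2]
      simp
  have h2 : ∀ j ∈ Finset.range m, (X j - Y j) - (c j : ℂ) • Q ∈ U := by
    intro j hj
    have a1 := mode_f_mode_e_sub_mem t hU hh m j (Finset.mem_range.mp hj) hq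
    have a2 := mode_e_mode_f_sub_mem t hU hh m j (by omega) (hq m (by omega) le_rfl)
    convert U.sub_mem a1 a2 using 1
    rw [hef]
    simp only [c, X, Y, ← hQ]
    split_ifs <;> (push_cast; module)
  have h3 : (∑ j ∈ Finset.range m, ((j + 1 : ℝ) * c j : ℝ) : ℂ) • Q ∈ U := by
    have h4 : ∑ j ∈ Finset.range m, ((j : ℂ) + 1) • ((X j - Y j) - (c j : ℂ) • Q) ∈ U :=
      U.sum_mem fun j hj => U.smul_mem _ (h2 j hj)
    have h5 := U.sub_mem h1 h4
    convert h5 using 1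
    rw [← Finset.sum_sub_distrib, Finset.sum_smul]
    refine Finset.sum_congr rfl fun j _ => ?_
    push_cast
    module
  have h6 : (∑ j ∈ Finset.range m, ((j + 1 : ℝ) * c j : ℝ) : ℂ) ≠ 0 := by
    rw [← Complex.ofReal_sum, Complex.ofReal_ne_zero]
    refine (Finset.sum_pos (fun j _ => mul_pos (by positivity) (hc j)) ⟨0, ?_⟩).ne'
    exact Finset.mem_range.mpr (by omega)
  exact (U.smul_mem_iff h6).mp h3

/-- If `h(-1)𝟙` and `f(-2)e(-1)𝟙` belong to a vertex subalgebra, so do all `f(i)e(-1)𝟙`. -/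
theorem mode_f_mem (r : ℝ) (hr : 0 ≤ r) (hef : Φ.form e f * k = r)
    (hw : mode Φ k f (-2) (mode Φ k e (-1) (vacuum Φ k)) ∈ U) (i : ℤ) :
    mode Φ k f i (mode Φ k e (-1) (vacuum Φ k)) ∈ U := by
  rcases le_or_gt 0 i with hi | hi
  · exact mode_f_nonneg_mem t hU hh i hi
  obtain ⟨m, rfl⟩ : ∃ m : ℕ, i = -(m + 1 : ℕ) := ⟨(-i - 1).toNat, by omega⟩
  induction m using Nat.strong_induction_on with
  | _ m ih =>
    rcases m with _ | _ | m
    -- The one case below the generator: h(1)f(-2)e(-1)𝟙 = -2f(-1)e(-1)𝟙.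
    · have h1 := hU.mode_mem hh 1 hw
      rw [mode_h_mode_f t, mode_h_mode_e t, mode_vacuum _ _ h _ (by norm_num),
        show (1 + -1 : ℤ) = 0 by norm_num, mode_vacuum _ _ e _ le_rfl] at h1
      simp only [map_zero, smul_zero, add_zero, zero_sub] at h1
      rw [neg_mem_iff, U.smul_mem_iff two_ne_zero] at h1
      exact h1
    · exact hw
    · refine mode_f_succ_mem t hU hh r hr hef (m + 2) (by omega) fun i hi hi2 => ?_
      obtain ⟨j, rfl⟩ := Nat.exists_eq_add_of_le' hi
      exact ih j (by omega) (by omega)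

/-- Swapping e and f needs no second induction: up to a Cartan mode and a scalar on the vacuum, the
vector is f(-1)e(i)𝟙, and the pair f(p)e(q) already preserves U. -/
theorem mode_e_mem (r : ℝ) (hr : 0 ≤ r) (hef : Φ.form e f * k = r)
    (hw : mode Φ k f (-2) (mode Φ k e (-1) (vacuum Φ k)) ∈ U) (i : ℤ) :
    mode Φ k e i (mode Φ k f (-1) (vacuum Φ k)) ∈ U := by
  rw [mode_e_mode_f t]
  exact U.add_mem (U.add_mem (hU.mode_mode_mem (mode_f_mem t hU hh r hr hef hw) _ _ hU.vacuum_mem)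
    (hU.mode_mem hh _ hU.vacuum_mem)) (U.smul_mem _ hU.vacuum_mem)

end SlTwo

/-! ### Words in weight vectors and the weight-zero space. -/

section Words
open VertexOperator (ncoeff)
open LieAlgebra LieAlgebra.IsKilling LieModule

variable {𝔤 : Type*} [LieRing 𝔤] [LieAlgebra ℂ 𝔤]
  (H : LieSubalgebra ℂ 𝔤) [H.IsCartanSubalgebra] (Φ : InvariantForm 𝔤) (k : ℂ)

/-- A mode `a(n)` together with the weight of `a`. -/
structure WeightedMode where
  /-- the weight of the vector -/
  weight : H → ℂ
  /-- the weight vector -/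
  vec : 𝔤
  /-- the index of the mode -/
  index : ℤ
  mem : vec ∈ rootSpace H weight

variable {H}

/-- The vector `a₁(n₁)⋯aₛ(nₛ)𝟙`. -/
def word (l : List (WeightedMode H)) : VacuumModule Φ k :=
  l.foldr (fun x v => mode Φ k x.vec x.index v) (vacuum Φ k)

theorem word_cons (x : WeightedMode H) (l : List (WeightedMode H)) :
    word Φ k (x :: l) = mode Φ k x.vec x.index (word Φ k l) := rfl

/-- The total weight of a list of modes. -/
def totalWeight (l : List (WeightedMode H)) : H → ℂ := (l.map WeightedMode.weight).sum

theorem totalWeight_cons (x : WeightedMode H) (l : List (WeightedMode H)) :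
    totalWeight (x :: l) = x.weight + totalWeight l := by
  simp [totalWeight]

/-- The span of the words of length less than `N` and total weight `χ`. -/
def shortWords (N : ℕ) (χ : H → ℂ) : Submodule ℂ (VacuumModule Φ k) :=
  Submodule.span ℂ {v | ∃ l : List (WeightedMode H), l.length < N ∧ totalWeight l = χ ∧
    v = word Φ k l}

theorem mode_mem_shortWords (x : WeightedMode H) {N : ℕ} {χ : H → ℂ} {v : VacuumModule Φ k}
    (hv : v ∈ shortWords Φ k N χ) :
    mode Φ k x.vec x.index v ∈ shortWords Φ k (N + 1) (x.weight + χ) := by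
  induction hv using Submodule.span_induction with
  | zero => rw [map_zero]; exact Submodule.zero_mem _
  | add u v _ _ hu hv => rw [map_add]; exact Submodule.add_mem _ hu hv
  | smul r v _ hv => rw [map_smul]; exact Submodule.smul_mem _ r hv
  | mem v hv =>
    obtain ⟨l, hl, hw, rfl⟩ := hv
    exact Submodule.subset_span ⟨x :: l, by simpa using hl, by rw [totalWeight_cons, hw], rfl⟩

theorem mem_span_range_word [FiniteDimensional ℂ 𝔤] [IsKilling ℂ 𝔤]
    (v : VacuumModule Φ k) :
    v ∈ Submodule.span ℂ (Set.range (word (H := H) Φ k)) := by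
  refine vacuumModule_induction Φ k (Submodule.span ℂ (Set.range (word (H := H) Φ k)))
    (Submodule.subset_span ⟨[], rfl⟩) (fun a n v hv => ?_) v
  have ha : a ∈ ⨆ χ, rootSpace H χ := by simp [iSup_genWeightSpace_eq_top ℂ H 𝔤]
  induction ha using LieSubmodule.iSup_induction' with
  | zero => rw [mode_zero_left]; exact Submodule.zero_mem _
  | add a b _ _ ha hb => rw [mode_add]; exact Submodule.add_mem _ ha hb
  | mem χ a ha =>
    induction hv using Submodule.span_induction with
    | zero => rw [map_zero]; exact Submodule.zero_mem _
    | add u v _ _ hu hv => rw [map_add]; exact Submodule.add_mem _ hu hv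
    | smul r v _ hv => rw [map_smul]; exact Submodule.smul_mem _ r hv
    | mem v hv =>
      obtain ⟨l, rfl⟩ := hv
      exact Submodule.subset_span ⟨⟨χ, a, n, ha⟩ :: l, rfl⟩

variable [FiniteDimensional ℂ 𝔤] [IsSimple ℂ 𝔤]

/-- Permuting the letters of a word changes it by shorter words of the same weight. -/
theorem word_sub_word_mem_of_perm {l l' : List (WeightedMode H)} (h : l.Perm l') :
    word Φ k l - word Φ k l' ∈ shortWords Φ k l.length (totalWeight l) := by
  induction h with
  | nil => rw [sub_self]; exact Submodule.zero_mem _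
  | cons x _ ih =>
    rw [word_cons, word_cons, ← map_sub, totalWeight_cons]
    exact mode_mem_shortWords Φ k x ih
  | trans h1 h2 ih1 ih2 =>
    have e : totalWeight _ = totalWeight _ := (h1.map WeightedMode.weight).sum_eq
    rw [← h1.length_eq, ← e] at ih2
    convert Submodule.add_mem _ ih1 ih2 using 1
    abel
  | swap x y l =>
    -- The commutator leaves a bracket word one letter shorter and a central term two letters
    -- shorter. The central term has the right weight because Φ vanishes unless the two weights are
    -- opposite.
    rw [word_cons, word_cons, word_cons, word_cons, mode_comm]
    refine Submodule.add_mem _ (Submodule.subset_span ⟨⟨y.weight + x.weight, ⁅y.vec, x.vec⁆,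
      y.index + x.index, lie_mem_genWeightSpace_of_mem_genWeightSpace y.mem x.mem⟩ :: l, by simp,
      by simp only [totalWeight_cons, add_assoc], rfl⟩) ?_
    by_cases hw : y.weight + x.weight = 0
    · refine Submodule.smul_mem _ _ (Submodule.subset_span ⟨l, by simp, ?_, rfl⟩)
      rw [totalWeight_cons, totalWeight_cons, ← add_assoc, hw, zero_add]
    · rw [Φ.apply_eq_zero_of_add_ne_zero y.mem x.mem hw]
      simp

theorem mode_zero_word (h : H) (l : List (WeightedMode H)) :
    mode Φ k (h : 𝔤) 0 (word Φ k l) = totalWeight l h • word Φ k l := by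
  induction l with
  | nil =>
    change mode Φ k (h : 𝔤) 0 (vacuum Φ k) = _
    rw [mode_vacuum _ _ _ _ le_rfl]
    simp [totalWeight]
  | cons x l ih =>
    have := lie_eq_smul_of_mem_rootSpace x.mem h
    rw [H.coe_bracket_of_module] at this
    rw [word_cons, mode_mode, ih, this, mode_smul, totalWeight_cons, Pi.add_apply, add_smul,
      map_smul, zero_add]
    simp [add_comm]

theorem word_mem_weightSubspace (l : List (WeightedMode H)) :
    word Φ k l ∈ weightSubspace Φ k H (totalWeight l) :=
  fun h => mode_zero_word Φ k h l

/-- The operators h(0) commute, since the Cartan subalgebra is abelian and the central term at modes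
(0, 0) vanishes. Simultaneous generalized eigenspaces of commuting operators are independent, and
the weight spaces sit inside them. -/
theorem iSupIndep_weightSubspace : iSupIndep (weightSubspace Φ k H) := by
  have h := Module.End.independent_iInf_maxGenEigenspace_of_forall_mapsTo
    (fun h : H => mode Φ k (h : 𝔤) 0) (fun h h' μ => ?_)
  · refine h.mono fun χ v hv => ?_
    simp only [Submodule.mem_iInf]
    intro h
    refine Module.End.mem_maxGenEigenspace _ _ _ |>.mpr ⟨1, ?_⟩
    rw [pow_one, LinearMap.sub_apply, hv h]
    simp
  · refine Module.End.mapsTo_maxGenEigenspace_of_comm ?_ μ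
    refine LinearMap.ext fun v => ?_
    have e : ⁅(h' : 𝔤), (h : 𝔤)⁆ = 0 := by
      have := trivial_lie_zero H H h' h
      exact congrArg Subtype.val this
    have := mode_mode Φ k (h' : 𝔤) (h : 𝔤) 0 0 v
    rw [e, mode_zero_left] at this
    simpa using this

/-- The weight spaces of `V(k,0)` are spanned by words. -/
theorem weightSubspace_le_span_word (χ : H → ℂ) :
    weightSubspace Φ k H χ ≤ Submodule.span ℂ {v | ∃ l : List (WeightedMode H),
      totalWeight l = χ ∧ v = word Φ k l} := by
  set M : (H → ℂ) → Submodule ℂ (VacuumModule Φ k) := fun χ =>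
    Submodule.span ℂ {v | ∃ l : List (WeightedMode H), totalWeight l = χ ∧ v = word Φ k l}
  have hM : ∀ χ, M χ ≤ weightSubspace Φ k H χ := fun χ => Submodule.span_le.mpr (by
    rintro _ ⟨l, rfl, rfl⟩
    exact word_mem_weightSubspace Φ k l)
  have htop : M χ ⊔ ⨆ ψ ≠ χ, weightSubspace Φ k H ψ = ⊤ := by
    refine eq_top_iff.mpr fun v _ => ?_
    refine Submodule.span_le.mpr ?_ (mem_span_range_word (H := H) Φ k v)
    rintro _ ⟨l, rfl⟩
    by_cases h : totalWeight l = χ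
    · exact Submodule.mem_sup_left (Submodule.subset_span ⟨l, h, rfl⟩)
    · exact Submodule.mem_sup_right (Submodule.mem_iSup_of_mem _ (Submodule.mem_iSup_of_mem h
        (word_mem_weightSubspace Φ k l)))
  have hdis := (iSupIndep_weightSubspace (H := H) Φ k) χ
  -- Modular law: the span of words of weight χ lies in the weight space, and together with the
  -- other weight spaces, which meet it trivially, it fills V(k,0).
  have e := sup_inf_assoc_of_le (⨆ ψ ≠ χ, weightSubspace Φ k H ψ) (hM χ)
  rw [htop, top_inf_eq, inf_comm, hdis.eq_bot, sup_bot_eq] at e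
  exact e.le

variable {Φ k} {U : Submodule ℂ (VacuumModule Φ k)}

/-- A vertex subalgebra that contains the currents of the Cartan subalgebra and is stable under
the operators `a(p)b(q)`, for `a` and `b` of opposite weights, contains all words of weight zero. -/
theorem word_mem_of_totalWeight_eq_zero (h1 : vacuum Φ k ∈ U)
    (hcartan : ∀ (h : H) (n : ℤ), ∀ v ∈ U, mode Φ k (h : 𝔤) n v ∈ U)
    (hroot : ∀ (α : H.root) (a b : 𝔤), a ∈ rootSpace H α.1 → b ∈ rootSpace H (-α.1 : H → ℂ) →
      ∀ (p q : ℤ), ∀ v ∈ U, mode Φ k a p (mode Φ k b q v) ∈ U)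
    (l : List (WeightedMode H)) (hl : totalWeight l = 0) : word Φ k l ∈ U := by
  induction hN : l.length using Nat.strong_induction_on generalizing l with
  | _ N ih =>
    subst hN
    have hshort : shortWords Φ k l.length (0 : H → ℂ) ≤ U := Submodule.span_le.mpr (by
      rintro _ ⟨l', hlen, hw, rfl⟩
      exact ih _ hlen l' hw rfl)
    have hperm : ∀ l', l.Perm l' → word Φ k l' ∈ U → word Φ k l ∈ U := fun l' hp hl' => by
      have := word_sub_word_mem_of_perm Φ k hp
      rw [hl] at this
      simpa using U.add_mem (hshort this) hl'
    by_cases hvec : ∃ x ∈ l, x.vec = 0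
    · obtain ⟨x, hx, hx0⟩ := hvec
      obtain ⟨s, t, rfl⟩ := List.append_of_mem hx
      refine hperm _ List.perm_middle ?_
      rw [word_cons, hx0, mode_zero_left]
      exact U.zero_mem
    push Not at hvec
    by_cases hzero : ∃ x ∈ l, x.weight = 0
    · obtain ⟨x, hx, hx0⟩ := hzero
      obtain ⟨s, t, rfl⟩ := List.append_of_mem hx
      refine hperm _ List.perm_middle ?_
      have hw : totalWeight (x :: (s ++ t)) = 0 := by
        rw [← hl]
        exact ((List.perm_middle (a := x)).map WeightedMode.weight).sum_eq.symm
      rw [totalWeight_cons, hx0, zero_add] at hw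
      have hmem : x.vec ∈ H := by
        have := x.mem
        rw [hx0] at this
        simpa using this
      exact hcartan ⟨x.vec, hmem⟩ _ _ (ih _ (by simp) _ hw rfl)
    push Not at hzero
    rcases l with _ | ⟨x, l⟩
    · exact h1
    have hweight : ∀ y ∈ x :: l, ∃ α : H.root, (α.1 : H → ℂ) = y.weight := fun y hy =>
      let α : Weight ℂ H 𝔤 := ⟨y.weight, fun h => hvec y hy (by simpa [rootSpace, h] using y.mem)⟩
      ⟨⟨α, Finset.mem_filter.mpr ⟨Finset.mem_univ _, hzero y hy⟩⟩, rfl⟩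
    obtain ⟨α, hα⟩ := hweight x (List.mem_cons_self)
    have hα0 := H.isNonZero_coe_root α
    -- The weights sum to zero and the first letter contributes α(α^∨) = 2, so the integers
    -- contributed by the other letters cannot all be nonnegative.
    obtain ⟨y, hy, z, hz, hyz⟩ : ∃ y ∈ l, ∃ z : ℤ, z < 0 ∧ y.weight (coroot α.1) = z := by
      by_contra! hcon
      have hnn : ∀ y ∈ l, ∃ n : ℕ, y.weight (coroot α.1) = n := by
        intro y hy
        obtain ⟨β, hβ⟩ := hweight y (List.mem_cons_of_mem _ hy)
        have e := apply_coroot_eq_cast α.1 β.1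
        rw [hβ] at e
        have h0 : 0 ≤ ((chainBotCoeff α.1 β.1 : ℤ) - chainTopCoeff α.1 β.1) := by
          by_contra! hlt
          exact hcon y hy _ hlt e
        obtain ⟨n, hn⟩ := Int.eq_ofNat_of_zero_le h0
        exact ⟨n, by rw [e, hn]; simp⟩
      have hs : ∃ n : ℕ, totalWeight l (coroot α.1) = n := by
        clear hcon hl ih hshort hperm hvec hzero hweight
        induction l with
        | nil => exact ⟨0, by simp [totalWeight]⟩
        | cons y l ihl =>
          obtain ⟨n, hn⟩ := ihl fun y hy => hnn y (List.mem_cons_of_mem _ hy)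
          obtain ⟨m, hm⟩ := hnn y List.mem_cons_self
          exact ⟨m + n, by rw [totalWeight_cons, Pi.add_apply, hn, hm]; push_cast; rfl⟩
      obtain ⟨n, hn⟩ := hs
      have := congrFun hl (coroot α.1)
      rw [totalWeight_cons, Pi.add_apply, hn, ← hα, root_apply_coroot hα0, Pi.zero_apply] at this
      have : (2 + n : ℕ) = 0 := by exact_mod_cast this
      omega
    obtain ⟨s, t, rfl⟩ := List.append_of_mem hy
    refine hperm (x :: y :: (s ++ t)) (List.Perm.cons x List.perm_middle) ?_
    have hw : x.weight + (y.weight + totalWeight (s ++ t)) = 0 := by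
      rw [← hl, ← totalWeight_cons, ← totalWeight_cons]
      exact (((List.perm_middle (a := y)).cons x).map WeightedMode.weight).sum_eq.symm
    rw [word_cons, word_cons]
    set w := word Φ k (s ++ t)
    obtain ⟨β, hβ⟩ := hweight y (by simp)
    by_cases hopp : x.weight + y.weight = 0
    · have hy' := y.mem
      rw [eq_neg_of_add_eq_zero_right hopp, ← hα] at hy'
      refine hroot α _ _ (hα ▸ x.mem) hy' _ _ _ (ih _ ?_ _ ?_ rfl)
      · simp
      · rwa [← add_assoc, hopp, zero_add] at hw
    obtain ⟨h, e, f, hef, he, hf⟩ := exists_isSl2Triple_of_weight_isNonZero hα0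
    obtain ⟨g, hg, hgy⟩ := exists_lie_eq_of_apply_coroot_neg α hef he hf β.1
      (H.isNonZero_coe_root β) z hz (by rw [hβ]; exact hyz) (hβ ▸ y.mem)
    -- With f(M)w = 0 and y.vec = [f, g], the commutator gives f(M)g(n-M)w = y(n)w for n the index
    -- of y. The central term vanishes because the weights of f and g add up to β ≠ 0. So x(p)y(n)w
    -- is an opposite pair x(p)f(M) applied to g(n-M)w, a word of weight zero with one letter fewer.
    obtain ⟨M, hM⟩ := mode_truncated Φ k f w
    have hmem : mode Φ k g (y.index - M) w ∈ U := by
      refine ih _ ?_ ((⟨_, g, y.index - M, hg⟩ : WeightedMode H) :: (s ++ t)) ?_ rfl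
      · simp
      · rw [totalWeight_cons, ← hw, ← hα, ← hβ, add_assoc]
    have h2 := hroot α _ _ (hα ▸ x.mem) hf x.index M _ hmem
    rw [mode_mode Φ k f g, hM M le_rfl, map_zero, zero_add, ← hgy, add_sub_cancel,
      Φ.apply_eq_zero_of_add_ne_zero hf hg (by
        rw [neg_add_cancel_left]
        exact H.isNonZero_coe_root β)] at h2
    simpa using h2

end Words

/-! ### Assembling the stability of the generated subalgebra. -/

section Generation
open LieAlgebra LieAlgebra.IsKilling LieModule

variable {𝔤 : Type*} [LieRing 𝔤] [LieAlgebra ℂ 𝔤] [FiniteDimensional ℂ 𝔤] [IsSimple ℂ 𝔤]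
  {H : LieSubalgebra ℂ 𝔤} [H.IsCartanSubalgebra] {Φ : InvariantForm 𝔤} {k : ℂ}

theorem IsVertexSubalgebra.cartan_mode_mem {U : Submodule ℂ (VacuumModule Φ k)}
    (hU : IsVertexSubalgebra Φ k U) (b : (rootSystem H).Base) (hΦ : Φ.form.Nondegenerate)
    (t : H.root → H) (ht : ∀ (α : H.root) (h : H), Φ.form (t α) h = α.1 h)
    (htU : ∀ α ∈ b.support, mode Φ k (t α : 𝔤) (-1) (vacuum Φ k) ∈ U) (h : H) (n : ℤ)
    (v : VacuumModule Φ k) (hv : v ∈ U) : mode Φ k (h : 𝔤) n v ∈ U := by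
  refine hU.mode_mem ?_ n hv
  induction mem_span_image_support b Φ hΦ t ht h using Submodule.span_induction with
  | zero => rw [ZeroMemClass.coe_zero, mode_zero_left]; exact U.zero_mem
  | add x y _ _ hx hy => rw [H.coe_add, mode_add]; exact U.add_mem hx hy
  | smul r x _ hx => rw [H.coe_smul, mode_smul]; exact U.smul_mem r hx
  | mem x hx =>
    obtain ⟨α, hα, rfl⟩ := hx
    exact htU α hα

/-- Root vectors of opposite weights preserve a vertex subalgebra in pairs, as soon as one
quadratic vector lies in it. -/
theorem IsVertexSubalgebra.root_mode_mode_mem {U : Submodule ℂ (VacuumModule Φ k)}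
    (hU : IsVertexSubalgebra Φ k U) {r : ℝ} (hr : 0 ≤ r) (α : H.root) {h e f : 𝔤}
    (hef : IsSl2Triple h e f) (he : e ∈ rootSpace H α.1) (hf : f ∈ rootSpace H (-α.1 : H → ℂ))
    (hk : Φ.form e f * k = r) (hh : mode Φ k h (-1) (vacuum Φ k) ∈ U)
    (hw : mode Φ k f (-2) (mode Φ k e (-1) (vacuum Φ k)) ∈ U) {a b : 𝔤}
    (ha : a ∈ rootSpace H α.1) (hb : b ∈ rootSpace H (-α.1 : H → ℂ)) (p q : ℤ)
    {v : VacuumModule Φ k} (hv : v ∈ U) :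
    mode Φ k a p (mode Φ k b q v) ∈ U ∧ mode Φ k b p (mode Φ k a q v) ∈ U := by
  have hα := H.isNonZero_coe_root α
  obtain ⟨c, rfl⟩ := mem_span_of_mem_rootSpace α.1 hα he hef.e_ne_zero ha
  -- Root spaces are lines, so arbitrary vectors of weights α and -α reduce to multiples of e and f.
  obtain ⟨d, rfl⟩ := mem_span_of_mem_rootSpace (-α.1) hα.neg hf hef.f_ne_zero hb
  simp only [mode_smul, map_smul]
  exact ⟨U.smul_mem _ (U.smul_mem _ (hU.mode_mode_mem (mode_e_mem hef hU hh r hr hk hw) p q hv)),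
    U.smul_mem _ (U.smul_mem _ (hU.mode_mode_mem (mode_f_mem hef hU hh r hr hk hw) p q hv))⟩

end Generation

end AffineVOA
end


theorem theorem2p1 {𝔤 : Type*} [LieRing 𝔤] [LieAlgebra ℂ 𝔤] [FiniteDimensional ℂ 𝔤]
    [LieAlgebra.IsSimple ℂ 𝔤]
    -- a Cartan subalgebra and simple roots
    (H : LieSubalgebra ℂ 𝔤) [H.IsCartanSubalgebra]
    (b : (LieAlgebra.IsKilling.rootSystem H).Base)
    -- the nondegenerate invariant symmetric form with square length 2 on long roots,
    -- where `t α` represents the root `α`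
    (Φ : AffineVOA.InvariantForm 𝔤) (hΦ : Φ.form.Nondegenerate)
    (t : H.root → H) (ht : ∀ (α : H.root) (h : H), Φ.form (t α) h = α.1 h)
    (hlong : ∀ α : H.root, AffineVOA.IsLongRoot H α → Φ.form (t α) (t α) = 2)
    -- root vectors `x α`, `x (-α)` for the positive roots `α`
    (x : LieModule.Weight ℂ H 𝔤 → 𝔤)
    (hx : ∀ α : H.root, b.IsPos α →
      x α.1 ∈ LieAlgebra.rootSpace H (α.1 : H → ℂ) ∧
      x (-α.1) ∈ LieAlgebra.rootSpace H ((-α.1 : LieModule.Weight ℂ H 𝔤) : H → ℂ) ∧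
      IsSl2Triple ((2 / Φ.form (t α) (t α)) • (t α : 𝔤)) (x α.1) (x (-α.1)))
    (k : ℕ) (hk : 1 ≤ k) :
    AffineVOA.generatedSubalgebra Φ (k : ℂ)
      ({v | ∃ α ∈ b.support, v = AffineVOA.mode Φ k (t α : 𝔤) (-1) (AffineVOA.vacuum Φ k)} ∪
        {v | ∃ α : H.root, b.IsPos α ∧ v = AffineVOA.mode Φ k (x (-α.1)) (-2)
          (AffineVOA.mode Φ k (x α.1) (-1) (AffineVOA.vacuum Φ k))}) =
      AffineVOA.weightSubspace Φ (k : ℂ) H 0 := by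
  open AffineVOA in
  set U := generatedSubalgebra Φ (k : ℂ) _ with hUdef
  have hU : IsVertexSubalgebra Φ (k : ℂ) U := isVertexSubalgebra_generatedSubalgebra Φ _ _
  have hgen := subset_generatedSubalgebra Φ (k : ℂ)
      ({v | ∃ α ∈ b.support, v = AffineVOA.mode Φ k (t α : 𝔤) (-1) (AffineVOA.vacuum Φ k)} ∪
        {v | ∃ α : H.root, b.IsPos α ∧ v = AffineVOA.mode Φ k (x (-α.1)) (-2)
          (AffineVOA.mode Φ k (x α.1) (-1) (AffineVOA.vacuum Φ k))})
  have htmem : ∀ h : H, (h : 𝔤) ∈ LieAlgebra.rootSpace H (0 : H → ℂ) := fun h => by simp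
  apply le_antisymm
  · refine sInf_le ⟨isVertexSubalgebra_weightSubspace_zero Φ _ H, Set.union_subset ?_ ?_⟩
    · rintro _ ⟨α, -, rfl⟩
      have := word_mem_weightSubspace Φ (k : ℂ)
        [(⟨0, t α, -1, htmem (t α)⟩ : WeightedMode H)]
      simpa [totalWeight, word] using this
    · rintro _ ⟨α, hα, rfl⟩
      have := word_mem_weightSubspace Φ (k : ℂ)
        [(⟨_, x (-α.1), -2, (hx α hα).2.1⟩ : WeightedMode H), ⟨_, x α.1, -1, (hx α hα).1⟩]
      simpa [totalWeight, word] using this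
  · have hcartan := hU.cartan_mode_mem b hΦ t ht fun α hα => hgen (Or.inl ⟨α, hα, rfl⟩)
    have hpos : ∀ α : H.root, b.IsPos α → ∀ (a c : 𝔤), a ∈ LieAlgebra.rootSpace H α.1 →
        c ∈ LieAlgebra.rootSpace H (-α.1 : H → ℂ) → ∀ (p q : ℤ), ∀ v ∈ U,
        mode Φ k a p (mode Φ k c q v) ∈ U ∧ mode Φ k c p (mode Φ k a q v) ∈ U := by
      intro α hα a c ha hc p q v hv
      obtain ⟨h1, h2, h3⟩ := hx α hα
      obtain ⟨r, hr, hr'⟩ := exists_pos_form_eq Φ t ht hlong α h3 h1 h2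
      -- This is where positivity enters: Φ(e, f) is a positive real and k is a natural number, so
      -- the central contribution cannot cancel the others.
      exact hU.root_mode_mode_mem (r := r * k) (by positivity) α h3 h1 h2 (by rw [hr']; simp)
        (hcartan ((2 / Φ.form (t α) (t α)) • t α) _ _ hU.vacuum_mem)
        (hgen (Or.inr ⟨α, hα, rfl⟩)) ha hc p q hv
    refine (weightSubspace_le_span_word Φ (k : ℂ) 0).trans (Submodule.span_le.mpr ?_)
    rintro _ ⟨l, hl, rfl⟩
    refine word_mem_of_totalWeight_eq_zero hU.vacuum_mem hcartan (fun α a c ha hc p q v hv => ?_)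
      l hl
    -- Gives meaning to -α on root indices, via the reflection of α in itself. For a negative root,
    -- the second half of `hpos` at -α is the required statement with the two roles exchanged.
    let _ := (LieAlgebra.IsKilling.rootSystem H).indexNeg
    rcases RootPairing.Base.IsPos.or_neg b α with hα | hα
    · exact (hpos α hα a c ha hc p q v hv).1
    · have e : ((-α : H.root).1 : H → ℂ) = -(α.1 : H → ℂ) := by
        have := (LieAlgebra.IsKilling.rootSystem H).root_reflectionPerm α α
        rw [RootPairing.reflection_apply_self] at this
        exact congrArg (fun f : Module.Dual ℂ H => (f : H → ℂ)) this
      exact (hpos (-α) hα c a (by rwa [e]) (by rwa [e, neg_neg]) p q v hv).2
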